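/- Let $\lambda\in\mathbb{C}$ with $|\lambda|<1$, let $\mathbb{T}^2=\{(z_1,z_2)\in\mathbb{C}^2:|z_1|=|z_2|=1\}$ be the complex unit torus, let $\mu$ be the normalised Haar measure on $\mathbb{T}^2$, and let $T:\mathbb{T}^2\to\mathbb{T}^2$ be the map $$T(z_1,z_2)=\left(z_1\,\frac{z_1-\lambda}{1-\bar\lambda z_1}\,z_2,\ \frac{z_1-\lambda}{1-\bar\lambda z_1}\,z_2\right).$$ For any functions $g,h:\mathbb{T}^2\to\mathbb{C}$ that are analytic in an open neighbourhood of $\mathbb{T}^2$ in $\mathbb{C}^2$ (that is, restrictions to $\mathbb{T}^2$ of functions analytic on such a neighbourhood), the correlation function $$C_{gh}(k)=\int g\cdot (h\circ T^k)\,d\mu-\int g\,d\mu\int h\,d\mu\qquad(k\in\mathbb{N})$$ satisfies $$\limsup_{k\to\infty}|C_{gh}(k)|^{1/k}\le|\lambda|.$$ In particular, $T$ is strongly mixing with respect to $\mu$: $T$ preserves $\mu$, and $\mu(A\cap T^{-k}B)\to\mu(A)\mu(B)$ as $k\to\infty$ for all Borel sets $A,B\subseteq\mathbb{T}^2$. 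-/

import Mathlib

open Filter Topology MeasureTheory
open scoped ENNReal ComplexConjugate

noncomputable section

/-- The Borel σ-algebra on the unit circle (Mathlib does not declare one). -/
instance Circle.instMeasurableSpaceBorel : MeasurableSpace Circle := borel Circle

instance Circle.instBorelSpaceBorel : BorelSpace Circle := ⟨rfl⟩

/-- The complex unit torus `{(z₁, z₂) ∈ ℂ² : |z₁| = |z₂| = 1}`. -/
abbrev Torus : Type := Circle × Circle

/-- The inclusion of the unit torus into `ℂ²`. -/
def Torus.toComplex (z : Torus) : ℂ × ℂ := ((z.1 : ℂ), (z.2 : ℂ))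

/-- The normalised Haar measure on the unit torus: total mass one. -/
def torusHaar : Measure Torus :=
  Measure.haarMeasure (⊤ : TopologicalSpace.PositiveCompacts Torus)

theorem torusHaar_univ : torusHaar Set.univ = 1 :=
  Measure.haarMeasure_self (K₀ := (⊤ : TopologicalSpace.PositiveCompacts Torus))

/-- A Blaschke factor maps the unit circle to itself. -/
theorem norm_blaschke {lam : ℂ} (hlam : ‖lam‖ < 1) (z : Circle) :
    ‖((z : ℂ) - lam) / (1 - conj lam * z)‖ = 1 := by
  have hz : (z : ℂ) * conj (z : ℂ) = 1 := by
    rw [Complex.mul_conj, Circle.normSq_coe, Complex.ofReal_one]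
  have h1 : 1 - conj lam * (z : ℂ) = z * conj ((z : ℂ) - lam) := by
    rw [map_sub, mul_sub, hz, mul_comm]
  have h2 : (z : ℂ) - lam ≠ 0 := by
    intro h
    rw [← sub_eq_zero.mp h, Circle.norm_coe] at hlam
    exact lt_irrefl _ hlam
  rw [h1, norm_div, norm_mul, Circle.norm_coe, one_mul, Complex.norm_conj,
    div_self (norm_ne_zero_iff.mpr h2)]

/-- The Blaschke factor `z ↦ (z - λ) / (1 - λ̄ z)` as a map of the unit circle, `|λ| < 1`. -/
def blaschke (lam : ℂ) (hlam : ‖lam‖ < 1) (z : Circle) : Circle :=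
  ⟨((z : ℂ) - lam) / (1 - conj lam * z), mem_sphere_zero_iff_norm.mpr (norm_blaschke hlam z)⟩

/-- The map `T (z₁, z₂) = (z₁ b(z₁) z₂, b(z₁) z₂)` of the unit torus, where `b` is the Blaschke
factor with parameter `λ`, `|λ| < 1`. -/
def blaschkeTorusMap (lam : ℂ) (hlam : ‖lam‖ < 1) (z : Torus) : Torus :=
  (z.1 * blaschke lam hlam z.1 * z.2, blaschke lam hlam z.1 * z.2)

/-- A function on the unit torus that is analytic in an open neighbourhood of the torus, that is,
the restriction of a function of two complex variables analytic on such a neighbourhood. -/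
def AnalyticNearTorus (g : Torus → ℂ) : Prop :=
  ∃ (U : Set (ℂ × ℂ)) (G : ℂ × ℂ → ℂ), IsOpen U ∧ Set.range Torus.toComplex ⊆ U ∧
    AnalyticOnNhd ℂ G U ∧ ∀ z : Torus, g z = G z.toComplex

/-- The correlation function `C_gh(k) = ∫ g · h ∘ T^k dμ - ∫ g dμ ∫ h dμ`. -/
def correlation {X : Type*} [MeasurableSpace X] (T : X → X) (μ : Measure X) (g h : X → ℂ)
    (k : ℕ) : ℂ :=
  (∫ x, g x * h (T^[k] x) ∂μ) - (∫ x, g x ∂μ) * ∫ x, h x ∂μ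

/-- Strong mixing of `T` with respect to an invariant probability measure `μ`. -/
def StronglyMixing {X : Type*} [MeasurableSpace X] (T : X → X) (μ : Measure X) : Prop :=
  MeasurePreserving T μ μ ∧
    ∀ A B : Set X, MeasurableSet A → MeasurableSet B →
      Tendsto (fun k : ℕ => μ (A ∩ T^[k] ⁻¹' B)) atTop (𝓝 (μ A * μ B))

end

/-! Write b for the Blaschke factor and χ_(x,y) = z₁^x z₂^(y-x). With this indexing χ_(x,y) ∘ T =
z₁^x z₂^y b(z₁)^y. Since b is holomorphic beyond the closed unit disc, b^y has only nonnegative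
Fourier frequencies for y ≥ 0, and, by conjugation, only nonpositive ones for y < 0. So T sends the
frequency (x, y) to the frequencies (x ± j, x ± j + y), j ≥ 0, with the sign of y. This
one-sidedness yields a height that never drops along a transition with nonzero coefficient
(`freqHeight_transferIndex_le`). Away from the zero frequency it stays constant only on the loops
(0, y) → (0, y), whose coefficient (-λ)^|y| has modulus at most |λ|: this is the source of the rate.

Hence for every θ > |λ| some weight W, decreasing in the height, is contracted by the factor θ
(`exists_contracting_weight`), and induction on k gives ∫ g · χ_n ∘ T^k = O(θ^k W(n)) for n ≠ 0
(`norm_integral_mul_torusChar_iterate_le`). Up to constants W lies between exp(-δ|n|) and exp(δ|n|)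
with δ > 0 as small as desired, so the exponentially decaying Fourier coefficients of g and h absorb
it. Summing over the frequencies of h, where n = 0 contributes exactly ∫ g ∫ h, gives
`exists_norm_correlation_le`; then θ ↓ |λ|. Strong mixing follows from the invariance of μ and the
L¹-density of trigonometric polynomials. -/

noncomputable section

/-! ### Taylor coefficients of powers of the Blaschke factor. -/

/-- The `j`-th Taylor coefficient at the origin of the `N`-th power of the Blaschke factor. -/
def blaschkeCoeff (lam : ℂ) (N j : ℕ) : ℂ :=
  (j.factorial : ℂ)⁻¹ * iteratedDeriv j (fun z : ℂ => ((z - lam) / (1 - conj lam * z)) ^ N) 0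

theorem one_sub_conj_mul_ne_zero {lam z : ℂ} (h : ‖lam‖ * ‖z‖ < 1) : 1 - conj lam * z ≠ 0 := by
  intro h0
  have : ‖conj lam * z‖ = 1 := by rw [← sub_eq_zero.mp h0, norm_one]
  rw [norm_mul, Complex.norm_conj] at this
  linarith

theorem differentiableOn_blaschke_pow (lam : ℂ) (N : ℕ) {R : ℝ} (hR : ‖lam‖ * R ≤ 1) :
    DifferentiableOn ℂ (fun z : ℂ => ((z - lam) / (1 - conj lam * z)) ^ N) (Metric.ball 0 R) := by
  refine DifferentiableOn.pow (DifferentiableOn.div (by fun_prop) (by fun_prop) fun z hz => ?_) N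
  refine one_sub_conj_mul_ne_zero ?_
  rw [mem_ball_zero_iff] at hz
  rcases (norm_nonneg lam).eq_or_lt with h | h
  · rw [← h]; simp
  · nlinarith

/-- Supplies a radius strictly between the unit circle and the modulus 1/|λ| of the pole. -/
theorem exists_one_lt_mul_norm_lt_one {lam : ℂ} (hlam : ‖lam‖ < 1) :
    ∃ R : ℝ, 1 < R ∧ ‖lam‖ * R < 1 := by
  refine ⟨2 / (1 + ‖lam‖), ?_, ?_⟩ <;> have := norm_nonneg lam
  · rw [lt_div_iff₀ (by positivity)]; linarith
  · rw [← mul_div_assoc, div_lt_one (by positivity)]; linarith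

theorem blaschkeCoeff_zero_right (lam : ℂ) (N : ℕ) : blaschkeCoeff lam N 0 = (-lam) ^ N := by
  simp [blaschkeCoeff]

theorem blaschkeCoeff_zero_left (lam : ℂ) {j : ℕ} (hj : j ≠ 0) : blaschkeCoeff lam 0 j = 0 := by
  simp [blaschkeCoeff, iteratedDeriv_const, hj]

theorem hasSum_blaschkeCoeff {lam : ℂ} (hlam : ‖lam‖ < 1) (N : ℕ) (z : Circle) :
    HasSum (fun j => blaschkeCoeff lam N j * (z : ℂ) ^ j) ((blaschke lam hlam z : ℂ) ^ N) := by
  obtain ⟨R, hR1, hR2⟩ := exists_one_lt_mul_norm_lt_one hlam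
  have hz : (z : ℂ) ∈ Metric.ball (0 : ℂ) R :=
    mem_ball_zero_iff.mpr (by rwa [Circle.norm_coe])
  have h := Complex.hasSum_taylorSeries_on_ball
    (differentiableOn_blaschke_pow lam N hR2.le) hz
  simp only [sub_zero, smul_eq_mul] at h
  refine h.congr_fun fun j => ?_
  rw [blaschkeCoeff]
  ring

/-- Cauchy's estimate on the circle of radius r. It serves twice: r > 1 gives summability in j,
while r < 1, where the Blaschke factor is bounded by some B < 1, gives exponential decay in N. -/
theorem norm_blaschkeCoeff_le_of_bound {lam : ℂ} (N j : ℕ) {r B : ℝ}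
    (hr : 0 < r)
    (hr1 : ‖lam‖ * r < 1) (hB : ∀ z : ℂ, ‖z‖ = r → ‖(z - lam) / (1 - conj lam * z)‖ ≤ B) :
    ‖blaschkeCoeff lam N j‖ ≤ B ^ N / r ^ j := by
  have hd : DiffContOnCl ℂ (fun z : ℂ => ((z - lam) / (1 - conj lam * z)) ^ N)
      (Metric.ball 0 r) := by
    obtain ⟨R, hrR, hR⟩ : ∃ R, r < R ∧ ‖lam‖ * R < 1 := by
      have hc : Tendsto (fun R : ℝ => ‖lam‖ * R) (𝓝[>] r) (𝓝 (‖lam‖ * r)) :=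
        tendsto_nhdsWithin_of_tendsto_nhds (Continuous.tendsto (by fun_prop) r)
      obtain ⟨R, h1, h2⟩ := ((hc.eventually_lt_const hr1).and self_mem_nhdsWithin).exists
      exact ⟨R, h2, h1⟩
    refine DifferentiableOn.diffContOnCl ?_
    rw [closure_ball _ hr.ne']
    exact (differentiableOn_blaschke_pow lam N hR.le).mono
      (Metric.closedBall_subset_ball hrR)
  have h := Complex.norm_iteratedDeriv_le_of_forall_mem_sphere_norm_le j hr hd (C := B ^ N)
    fun z hz => by
      rw [norm_pow]
      exact pow_le_pow_left₀ (norm_nonneg _) (hB z (by simpa using hz)) N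
  have hj : (0 : ℝ) < j.factorial := by positivity
  rw [blaschkeCoeff, norm_mul, norm_inv, Complex.norm_natCast, inv_mul_le_iff₀ hj]
  exact h.trans_eq (mul_div_assoc _ _ _)

/-- On a circle of radius `r < 1` the Blaschke factor is bounded by a constant less than one. -/
theorem exists_blaschke_bound {lam : ℂ} (hlam : ‖lam‖ < 1) {r : ℝ} (hr : 0 < r) (hr1 : r < 1) :
    ∃ B : ℝ, 0 ≤ B ∧ B < 1 ∧ ∀ z : ℂ, ‖z‖ = r → ‖(z - lam) / (1 - conj lam * z)‖ ≤ B := by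
  have hne : ∀ z : ℂ, ‖z‖ = r → 1 - conj lam * z ≠ 0 := fun z hz =>
    one_sub_conj_mul_ne_zero (by rw [hz]; nlinarith [norm_nonneg lam])
  have hc : ContinuousOn (fun z : ℂ => ‖(z - lam) / (1 - conj lam * z)‖) (Metric.sphere 0 r) :=
    (ContinuousOn.div (by fun_prop) (by fun_prop) fun z hz => hne z (by simpa using hz)).norm
  obtain ⟨z, hz, hmax⟩ := (isCompact_sphere (0 : ℂ) r).exists_isMaxOn
    (NormedSpace.sphere_nonempty.mpr hr.le) hc
  have hz' : ‖z‖ = r := by simpa using hz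
  refine ⟨_, norm_nonneg _, ?_, fun w hw => hmax (by simpa using hw : w ∈ Metric.sphere (0:ℂ) r)⟩
  rw [norm_div, div_lt_one (norm_pos_iff.mpr (hne z hz'))]
  refine lt_of_pow_lt_pow_left₀ 2 (norm_nonneg _) ?_
  -- The Schwarz–Pick identity shows that the maximum over the circle is less than one.
  have key : ‖1 - conj lam * z‖ ^ 2 - ‖z - lam‖ ^ 2 = (1 - ‖lam‖ ^ 2) * (1 - ‖z‖ ^ 2) := by
    simp only [← Complex.normSq_eq_norm_sq, Complex.normSq_apply]
    simp
    ring
  have h1 : 0 < 1 - ‖lam‖ ^ 2 := by nlinarith [norm_nonneg lam]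
  have h2 : 0 < 1 - ‖z‖ ^ 2 := by rw [hz']; nlinarith
  nlinarith [mul_pos h1 h2]

theorem summable_norm_blaschkeCoeff {lam : ℂ} (hlam : ‖lam‖ < 1) (N : ℕ) :
    Summable fun j => ‖blaschkeCoeff lam N j‖ := by
  obtain ⟨R, hR1, hR2⟩ := exists_one_lt_mul_norm_lt_one hlam
  have hc : ContinuousOn (fun z : ℂ => (z - lam) / (1 - conj lam * z)) (Metric.sphere 0 R) :=
    ContinuousOn.div (by fun_prop) (by fun_prop) fun z hz =>
      one_sub_conj_mul_ne_zero (by rw [mem_sphere_zero_iff_norm.mp hz]; exact hR2)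
  obtain ⟨B, hB⟩ := (isCompact_sphere (0 : ℂ) R).exists_bound_of_continuousOn hc
  have hR0 : 0 < R := by linarith
  refine Summable.of_nonneg_of_le (fun _ => norm_nonneg _)
    (fun j => norm_blaschkeCoeff_le_of_bound N j hR0 hR2 fun z hz => hB z (by simpa using hz))
    ?_
  simp_rw [div_eq_mul_inv, ← inv_pow]
  exact (summable_geometric_of_lt_one (by positivity) (inv_lt_one_of_one_lt₀ hR1)).mul_left _

/-- For `0 < s < 1` the sums `∑ⱼ |cⱼ| sʲ` over the Taylor coefficients of the `N`-th power of the
Blaschke factor decay exponentially in `N`. -/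
theorem exists_tsum_blaschkeCoeff_le {lam : ℂ} (hlam : ‖lam‖ < 1) {s : ℝ} (hs : 0 < s)
    (hs1 : s < 1) :
    ∃ B D : ℝ, 0 ≤ B ∧ B < 1 ∧ 0 < D ∧
      ∀ N, ∑' j, ‖blaschkeCoeff lam N j‖ * s ^ j ≤ D * B ^ N := by
  -- Cauchy's estimate at a radius r in (s, 1) leaves a geometric series of ratio s / r, whose sum D
  -- does not depend on N.
  obtain ⟨r, hsr, hr1⟩ := exists_between hs1
  have hr : 0 < r := hs.trans hsr
  obtain ⟨B, hB0, hB1, hB⟩ := exists_blaschke_bound hlam hr hr1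
  have hq : s / r < 1 := (div_lt_one hr).mpr hsr
  have hq0 : 0 ≤ s / r := by positivity
  refine ⟨B, (1 - s / r)⁻¹, hB0, hB1, inv_pos.mpr (by linarith), fun N => ?_⟩
  have hle : ∀ j, ‖blaschkeCoeff lam N j‖ * s ^ j ≤ B ^ N * (s / r) ^ j := fun j => by
    have h := norm_blaschkeCoeff_le_of_bound N j hr (by nlinarith [norm_nonneg lam]) hB
    calc _ ≤ B ^ N / r ^ j * s ^ j := by gcongr
      _ = _ := by rw [div_pow]; ring
  have hsum := (summable_geometric_of_lt_one hq0 hq).mul_left (B ^ N)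
  refine ((hsum.of_nonneg_of_le (fun j => by positivity) hle).tsum_le_tsum hle hsum).trans_eq ?_
  rw [tsum_mul_left, tsum_geometric_of_lt_one hq0 hq, mul_comm]

/-! ### Transitions between frequencies and the height. -/

/-- The coefficients of the Fourier expansion of the `y`-th power of the Blaschke factor, `y ∈ ℤ`,
with respect to the characters `z ^ j` if `y ≥ 0` and `z ^ (-j)` if `y < 0`. -/
def transferCoeff (lam : ℂ) (y : ℤ) (j : ℕ) : ℂ :=
  if 0 ≤ y then blaschkeCoeff lam y.natAbs j else conj (blaschkeCoeff lam y.natAbs j)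

/-- The frequencies of the characters that occur in the image of a character under composition with
the map `blaschkeTorusMap`. The pair `(x, y)` stands for the character `z₁ ^ x * z₂ ^ (y - x)`. -/
def transferIndex (n : ℤ × ℤ) (j : ℕ) : ℤ × ℤ :=
  (n.1 + (if 0 ≤ n.2 then (j : ℤ) else -j), n.1 + (if 0 ≤ n.2 then (j : ℤ) else -j) + n.2)

/-- The `ℓ¹`-norm of a frequency. -/
def freqNorm (n : ℤ × ℤ) : ℤ := n.1.natAbs + n.2.natAbs

/-- A function on frequencies that increases along the transitions of `blaschkeTorusMap`. -/
def freqHeight (n : ℤ × ℤ) : ℤ :=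
  if (n.1 < 0 ∧ 0 < n.2) ∨ (0 < n.1 ∧ n.2 < 0) then -freqNorm n else freqNorm n

theorem norm_transferCoeff (lam : ℂ) (y : ℤ) (j : ℕ) :
    ‖transferCoeff lam y j‖ = ‖blaschkeCoeff lam y.natAbs j‖ := by
  unfold transferCoeff
  split_ifs
  · rfl
  · exact Complex.norm_conj _

theorem transferCoeff_zero_left (lam : ℂ) {j : ℕ} (hj : j ≠ 0) : transferCoeff lam 0 j = 0 := by
  simp [transferCoeff, blaschkeCoeff_zero_left lam hj]

/-- For y > 0, if x ≥ 0 the height gains x + 2j; if x < 0 it gains |x| or |x| + 2(|x| - j) while x +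
j < 0, and 2j - |x| + 2y once x + j ≥ 0. The case y < 0 is symmetric, and y = 0 gains |x|. The
hypothesis discards the transitions whose coefficient vanishes. Thus the gain is zero only for x =
0, j = 0. -/
theorem freqHeight_transferIndex_le (n : ℤ × ℤ) (j : ℕ) (h : n.2 = 0 → j = 0) :
    (n.1.natAbs + j : ℤ) ≤ 2 * (freqHeight (transferIndex n j) - freqHeight n) := by
  obtain ⟨x, y⟩ := n
  simp only [freqHeight, transferIndex, freqNorm] at h ⊢
  split_ifs <;> omega

/-- Keeps the induction among the nonzero frequencies, since correlations with the constant
character do not decay. -/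
theorem transferIndex_ne_zero {n : ℤ × ℤ} (hn : n ≠ 0) {j : ℕ} (h : n.2 = 0 → j = 0) :
    transferIndex n j ≠ 0 := by
  obtain ⟨x, y⟩ := n
  simp only [transferIndex, ne_eq, Prod.mk_eq_zero] at *
  split_ifs <;> omega

theorem freqHeight_le (n : ℤ × ℤ) : freqHeight n ≤ freqNorm n := by
  unfold freqHeight freqNorm
  split_ifs <;> omega

theorem neg_freqNorm_le (n : ℤ × ℤ) : -freqNorm n ≤ freqHeight n := by
  unfold freqHeight freqNorm
  split_ifs <;> omega

/-! ### A weight contracted by the transfer coefficients. -/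

/-- The clamp of an integer to the interval `[-R, R]`. -/
def intClamp (R t : ℤ) : ℤ := max (-R) (min R t)

/-- The weight `exp (-δ t) K ^ (-t)` of a frequency of height `t`, where the exponent of `K` is
clamped to `[-R, R]`. -/
def heightWeight (δ K : ℝ) (R t : ℤ) : ℝ := Real.exp (-δ * t) * K ^ (-intClamp R t)

theorem heightWeight_pos (δ : ℝ) {K : ℝ} (hK : 0 < K) (R t : ℤ) : 0 < heightWeight δ K R t :=
  mul_pos (Real.exp_pos _) (zpow_pos hK _)

theorem heightWeight_le (δ : ℝ) {K : ℝ} (hK : 1 ≤ K) (R t : ℤ) :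
    heightWeight δ K R t ≤ Real.exp (-δ * t) * K ^ R := by
  refine mul_le_mul_of_nonneg_left (zpow_le_zpow_right₀ hK ?_) (Real.exp_pos _).le
  unfold intClamp; omega

theorem le_heightWeight (δ : ℝ) {K : ℝ} (hK : 1 ≤ K) {R : ℤ} (hR : 0 ≤ R) (t : ℤ) :
    Real.exp (-δ * t) * K ^ (-R) ≤ heightWeight δ K R t := by
  refine mul_le_mul_of_nonneg_left (zpow_le_zpow_right₀ hK ?_) (Real.exp_pos _).le
  unfold intClamp; omega

theorem heightWeight_le_mul (δ : ℝ) {K : ℝ} (hK : 1 ≤ K) (R : ℤ) {t u : ℤ} (h : t ≤ u) :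
    heightWeight δ K R u ≤ Real.exp (-δ * (u - t : ℤ)) * heightWeight δ K R t := by
  have h1 : Real.exp (-δ * u) = Real.exp (-δ * (u - t : ℤ)) * Real.exp (-δ * t) := by
    rw [← Real.exp_add]; push_cast; ring_nf
  unfold heightWeight
  rw [h1, ← mul_assoc]
  refine mul_le_mul_of_nonneg_left (zpow_le_zpow_right₀ hK ?_) (by positivity)
  unfold intClamp; omega

/-- A strict rise starting in [-R, R) moves the clamped exponent by at least one, which gains a full
factor K⁻¹ on top of the exponential. -/
theorem heightWeight_le_mul_inv (δ : ℝ) {K : ℝ} (hK : 1 ≤ K) {R t u : ℤ} (h : t < u)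
    (ht : -R ≤ t) (htR : t < R) :
    heightWeight δ K R u ≤ Real.exp (-δ * (u - t : ℤ)) * heightWeight δ K R t * K⁻¹ := by
  have h1 : Real.exp (-δ * u) = Real.exp (-δ * (u - t : ℤ)) * Real.exp (-δ * t) := by
    rw [← Real.exp_add]; push_cast; ring_nf
  have h2 : K ^ (-intClamp R t) * K⁻¹ = K ^ (-intClamp R t - 1) := by
    rw [zpow_sub_one₀ (by positivity)]
  unfold heightWeight
  rw [h1, ← mul_assoc, mul_assoc _ _ K⁻¹, h2]
  refine mul_le_mul_of_nonneg_left (zpow_le_zpow_right₀ hK ?_) (by positivity)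
  unfold intClamp; omega

/-- For every `θ > |λ|` and every `δ > 0` the frequencies carry a weight, comparable to
`exp (-δ * height)`, which the moduli of the transfer coefficients contract by the factor `θ`. -/
theorem exists_contracting_weight {lam : ℂ} (hlam : ‖lam‖ < 1) {θ δ : ℝ} (hθ : ‖lam‖ < θ)
    (hδ : 0 < δ) :
    ∃ (K : ℝ) (R : ℤ), 1 ≤ K ∧ 0 ≤ R ∧ ∀ n : ℤ × ℤ, n ≠ 0 →
      Summable (fun j => ‖transferCoeff lam n.2 j‖ *
        heightWeight δ K R (freqHeight (transferIndex n j))) ∧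
      ∑' j, ‖transferCoeff lam n.2 j‖ * heightWeight δ K R (freqHeight (transferIndex n j))
        ≤ θ * heightWeight δ K R (freqHeight n) := by
  -- A transition raises the height by at least (|x| + j) / 2, so exp(-δ · gain) ≤ s^(|x| + j).
  set s := Real.exp (-δ / 2) with hs
  have hs0 : 0 < s := Real.exp_pos _
  have hs1 : s < 1 := by
    rw [hs, Real.exp_lt_one_iff]; linarith
  obtain ⟨B, D, hB0, hB1, hD, hsum⟩ := exists_tsum_blaschkeCoeff_le hlam hs0 hs1
  have hθ0 : 0 < θ := (norm_nonneg _).trans_lt hθ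
  -- From ℓ¹-norm M on, the decay s^|x| from the height and B^|y| from the coefficients together
  -- outweigh D.
  obtain ⟨M, hM⟩ : ∃ M : ℕ, D * (max s B) ^ M < θ := by
    have h := (tendsto_pow_atTop_nhds_zero_of_lt_one (le_max_of_le_left hs0.le)
      (max_lt hs1 hB1)).const_mul D
    rw [mul_zero] at h
    exact (h.eventually_lt_const hθ0).exists
  -- Chosen so that all transitions other than the loop contribute at most D K⁻¹ ≤ θ - |λ| at small
  -- frequencies.
  set K := max 1 (D / (θ - ‖lam‖)) with hKdef
  have hK1 : 1 ≤ K := le_max_left _ _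
  have hK0 : 0 < K := by linarith
  have hDK : D * K⁻¹ ≤ θ - ‖lam‖ := by
    rw [← div_eq_mul_inv, div_le_iff₀ hK0, mul_comm, ← div_le_iff₀ (by linarith)]
    exact le_max_right _ _
  refine ⟨K, M, hK1, by positivity, fun n hn => ?_⟩
  set W := heightWeight δ K M (freqHeight n) with hW
  have hW0 : 0 < W := heightWeight_pos _ hK0 _ _
  set a : ℕ → ℝ := fun j => ‖blaschkeCoeff lam n.2.natAbs j‖ * s ^ j with ha
  have ha0 : ∀ j, 0 ≤ a j := fun j => by positivity
  have hasum : Summable a := (summable_norm_blaschkeCoeff hlam n.2.natAbs).of_nonneg_of_le ha0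
    fun j => mul_le_of_le_one_right (norm_nonneg _) (pow_le_one₀ hs0.le hs1.le)
  have hexp : ∀ j, (n.2 = 0 → j = 0) →
      Real.exp (-δ * (freqHeight (transferIndex n j) - freqHeight n : ℤ))
        ≤ s ^ n.1.natAbs * s ^ j := fun j hj => by
    rw [← pow_add, hs, ← Real.exp_nat_mul]
    refine Real.exp_le_exp.mpr ?_
    have h : (((n.1.natAbs + j : ℕ) : ℤ) : ℝ)
        ≤ ((2 * (freqHeight (transferIndex n j) - freqHeight n) : ℤ) : ℝ) :=
      Int.cast_le.mpr (by exact_mod_cast freqHeight_transferIndex_le n j hj)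
    rw [Int.cast_natCast, Int.cast_mul, Int.cast_ofNat] at h
    nlinarith
  have hvanish : ∀ j, ¬ (n.2 = 0 → j = 0) → transferCoeff lam n.2 j = 0 := fun j hj => by
    push Not at hj
    rw [hj.1, transferCoeff_zero_left lam hj.2]
  have hterm : ∀ j, ‖transferCoeff lam n.2 j‖ *
      heightWeight δ K M (freqHeight (transferIndex n j)) ≤ s ^ n.1.natAbs * W * a j := fun j => by
    by_cases hj : n.2 = 0 → j = 0
    · have hh := freqHeight_transferIndex_le n j hj
      have hw := (heightWeight_le_mul δ hK1 M (t := freqHeight n)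
        (u := freqHeight (transferIndex n j)) (by omega)).trans
        (mul_le_mul_of_nonneg_right (hexp j hj) hW0.le)
      calc _ ≤ ‖transferCoeff lam n.2 j‖ * (s ^ n.1.natAbs * s ^ j * W) :=
            mul_le_mul_of_nonneg_left hw (norm_nonneg _)
        _ = _ := by rw [norm_transferCoeff, ha]; ring
    · rw [hvanish j hj]
      simp only [norm_zero, zero_mul]
      have := ha0 j
      positivity
  have hS : Summable (fun j => ‖transferCoeff lam n.2 j‖ *
      heightWeight δ K M (freqHeight (transferIndex n j))) :=
    (hasum.mul_left (s ^ n.1.natAbs * W)).of_nonneg_of_le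
      (fun j => mul_nonneg (norm_nonneg _) (heightWeight_pos _ hK0 _ _).le) hterm
  refine ⟨hS, ?_⟩
  rcases le_or_gt (M : ℤ) (freqNorm n) with hlarge | hsmall
  · calc _ ≤ ∑' j, s ^ n.1.natAbs * W * a j := hS.tsum_le_tsum hterm (hasum.mul_left _)
      _ = s ^ n.1.natAbs * W * ∑' j, a j := tsum_mul_left
      _ ≤ s ^ n.1.natAbs * W * (D * B ^ n.2.natAbs) := by gcongr; exact hsum _
      _ ≤ (max s B) ^ n.1.natAbs * W * (D * (max s B) ^ n.2.natAbs) := by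
          gcongr
          · exact le_max_left _ _
          · exact le_max_right _ _
      _ = D * (max s B) ^ (n.1.natAbs + n.2.natAbs) * W := by rw [pow_add]; ring
      _ ≤ D * (max s B) ^ M * W := by
          have : M ≤ n.1.natAbs + n.2.natAbs := by unfold freqNorm at hlarge; omega
          have hm := pow_le_pow_of_le_one (le_max_of_le_left hs0.le) (max_lt hs1 hB1).le this
          gcongr
      _ ≤ θ * W := by gcongr
  · have hdiag : ∀ j, ‖transferCoeff lam n.2 j‖ *
        heightWeight δ K M (freqHeight (transferIndex n j))
          ≤ (if j = 0 then ‖lam‖ * W else 0) + W * K⁻¹ * a j := fun j => by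
      -- The loop (0, y) → (0, y) leaves the weight unchanged, and only its coefficient contracts,
      -- by |λ|. Every other transition with nonzero coefficient raises the height and gains K⁻¹.
      by_cases h0 : j = 0 ∧ n.1 = 0
      · obtain ⟨rfl, hx⟩ := h0
        have hy : n.2 ≠ 0 := fun hy => hn (Prod.ext hx hy)
        have hidx : transferIndex n 0 = n := by
          obtain ⟨x, y⟩ := n
          simp_all [transferIndex]
        have hc : ‖transferCoeff lam n.2 0‖ ≤ ‖lam‖ := by
          rw [norm_transferCoeff, blaschkeCoeff_zero_right, norm_pow, norm_neg]
          exact pow_le_of_le_one (norm_nonneg _) hlam.le (Int.natAbs_ne_zero.mpr hy)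
        rw [hidx, if_pos rfl]
        have h1 := mul_le_mul_of_nonneg_right hc hW0.le
        have h2 : 0 ≤ W * K⁻¹ * a 0 := mul_nonneg (by positivity) (ha0 0)
        linarith
      · have hif : 0 ≤ if j = 0 then ‖lam‖ * W else 0 := by split_ifs <;> positivity
        refine le_trans ?_ (le_add_of_nonneg_left hif)
        by_cases hj : n.2 = 0 → j = 0
        · have hh := freqHeight_transferIndex_le n j hj
          have h1 := freqHeight_le n
          have h2 := neg_freqNorm_le n
          calc _ ≤ ‖transferCoeff lam n.2 j‖ * (1 * s ^ j * W * K⁻¹) := by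
                refine mul_le_mul_of_nonneg_left ((heightWeight_le_mul_inv δ hK1 (R := M)
                  (t := freqHeight n) (by omega) (by omega) (by omega)).trans ?_) (norm_nonneg _)
                refine mul_le_mul_of_nonneg_right (mul_le_mul_of_nonneg_right
                  ((hexp j hj).trans ?_) hW0.le) (by positivity)
                exact mul_le_mul_of_nonneg_right (pow_le_one₀ hs0.le hs1.le) (by positivity)
            _ = _ := by rw [norm_transferCoeff, ha]; ring
        · rw [hvanish j hj]
          have := ha0 j
          simp only [norm_zero, zero_mul]
          positivity
    have hsum1 : HasSum (fun j : ℕ => if j = 0 then ‖lam‖ * W else 0) (‖lam‖ * W) :=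
      hasSum_ite_eq 0 _
    have hsum2 := hsum1.add (hasum.mul_left (W * K⁻¹)).hasSum
    rw [tsum_mul_left] at hsum2
    have hA : ∑' j, a j ≤ D := (hsum _).trans
      (mul_le_of_le_one_right hD.le (pow_le_one₀ hB0 hB1.le))
    calc _ ≤ ‖lam‖ * W + W * K⁻¹ * ∑' j, a j := by
          rw [← hsum2.tsum_eq]; exact hS.tsum_le_tsum hdiag hsum2.summable
      _ ≤ ‖lam‖ * W + W * K⁻¹ * D := by gcongr
      _ = (‖lam‖ + D * K⁻¹) * W := by ring
      _ ≤ θ * W := by gcongr; linarith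

/-! ### Haar measure and its invariance under T. -/

instance Circle.instSecondCountable : SecondCountableTopology Circle :=
  TopologicalSpace.Subtype.secondCountableTopology _

instance torusHaar_isHaarMeasure : torusHaar.IsHaarMeasure := by
  unfold torusHaar; infer_instance

instance torusHaar_isProbabilityMeasure : IsProbabilityMeasure torusHaar := ⟨torusHaar_univ⟩

/-- The normalised Haar measure on the unit circle. -/
def circleHaar : Measure Circle :=
  Measure.haarMeasure (⊤ : TopologicalSpace.PositiveCompacts Circle)

instance circleHaar_isHaarMeasure : circleHaar.IsHaarMeasure := by
  unfold circleHaar; infer_instance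

instance circleHaar_isProbabilityMeasure : IsProbabilityMeasure circleHaar :=
  ⟨Measure.haarMeasure_self (K₀ := (⊤ : TopologicalSpace.PositiveCompacts Circle))⟩

theorem torusHaar_eq_prod : torusHaar = circleHaar.prod circleHaar :=
  Measure.isHaarMeasure_eq_of_isProbabilityMeasure _ _

theorem continuous_blaschke (lam : ℂ) (hlam : ‖lam‖ < 1) : Continuous (blaschke lam hlam) := by
  refine Continuous.subtype_mk ?_ _
  refine Continuous.div (by fun_prop) (by fun_prop) fun z h => ?_
  have h2 := norm_blaschke hlam z
  rw [h] at h2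
  simp at h2

theorem continuous_blaschkeTorusMap (lam : ℂ) (hlam : ‖lam‖ < 1) :
    Continuous (blaschkeTorusMap lam hlam) := by
  have h := (continuous_blaschke lam hlam).comp (continuous_fst (X := Circle) (Y := Circle))
  exact ((continuous_fst.mul h).mul continuous_snd).prodMk (h.mul continuous_snd)

/-- T is the fibrewise rotation (z₁, b(z₁) z₂) followed by the shear (z₂ z₁, z₂). Both preserve Haar
measure, although b itself need not preserve it on the circle. -/
theorem measurePreserving_blaschkeTorusMap (lam : ℂ) (hlam : ‖lam‖ < 1) :
    MeasurePreserving (blaschkeTorusMap lam hlam) torusHaar torusHaar := by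
  rw [torusHaar_eq_prod]
  have h1 : MeasurePreserving (fun z : Torus => (z.1, blaschke lam hlam z.1 * z.2))
      (circleHaar.prod circleHaar) (circleHaar.prod circleHaar) := by
    refine (MeasurePreserving.id circleHaar).skew_product
      (g := fun x y => blaschke lam hlam x * y) ?_ (ae_of_all _ fun x => ?_)
    · exact (((continuous_blaschke lam hlam).comp continuous_fst).mul continuous_snd).measurable
    · exact (measurePreserving_mul_left circleHaar _).map_eq
  have h2 : MeasurePreserving (fun z : Torus => (z.2 * z.1, z.2))
      (circleHaar.prod circleHaar) (circleHaar.prod circleHaar) :=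
    Measure.measurePreserving_swap.comp (measurePreserving_prod_mul_swap circleHaar circleHaar)
  convert h2.comp h1 using 1
  ext z <;> simp [blaschkeTorusMap]
  ring

/-- If the integrals of `f` along all translates of the path `e` on `[0, 2π]` are bounded by `M`, then so
is `2π` times the Haar integral of `f`. -/
theorem norm_integral_torusHaar_le_of_average {f : Torus → ℂ} (hf : Continuous f)
    {e : ℝ → Torus} (he : Continuous e) {M : ℝ}
    (hM : ∀ z, ‖∫ t in (0 : ℝ)..2 * Real.pi, f (e t * z)‖ ≤ M) :
    2 * Real.pi * ‖∫ z, f z ∂torusHaar‖ ≤ M := by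
  have hpi : (0 : ℝ) ≤ 2 * Real.pi := by positivity
  have hinv : ∀ t, ∫ z, f (e t * z) ∂torusHaar = ∫ z, f z ∂torusHaar := fun t =>
    integral_mul_left_eq_self f (e t)
  have h1 : ∫ t in (0 : ℝ)..2 * Real.pi, ∫ z, f (e t * z) ∂torusHaar
      = ((2 * Real.pi : ℝ) : ℂ) * ∫ z, f z ∂torusHaar := by
    simp_rw [hinv]
    rw [intervalIntegral.integral_const, sub_zero, Complex.real_smul]
  obtain ⟨C, hC⟩ := isCompact_univ.exists_bound_of_continuousOn hf.continuousOn
  have h2 : ∫ t in (0 : ℝ)..2 * Real.pi, ∫ z, f (e t * z) ∂torusHaar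
      = ∫ z, (∫ t in (0 : ℝ)..2 * Real.pi, f (e t * z)) ∂torusHaar := by
    refine intervalIntegral_integral_swap ?_
    have hc : Continuous (Function.uncurry fun t z => f (e t * z)) := by
      exact hf.comp ((he.comp continuous_fst).mul continuous_snd)
    have : IsFiniteMeasure (volume.restrict (Set.uIoc 0 (2 * Real.pi))) := ⟨by simp [Set.uIoc]⟩
    refine Integrable.mono' (g := fun _ => C) (integrable_const C) hc.aestronglyMeasurable
      (ae_of_all _ fun p => hC _ trivial)
  have h3 : ‖∫ z, (∫ t in (0 : ℝ)..2 * Real.pi, f (e t * z)) ∂torusHaar‖ ≤ M := by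
    refine (norm_integral_le_of_norm_le_const (ae_of_all _ hM)).trans ?_
    simp
  rw [← h2, h1, norm_mul, Complex.norm_real, Real.norm_of_nonneg hpi] at h3
  exact h3

/-! ### Characters of the torus and Fourier inversion. -/

/-- The character `z₁ ^ x * z₂ ^ (y - x)` of the torus, indexed by the pair `(x, y)`. -/
def torusChar (n : ℤ × ℤ) : C(Torus, ℂ) where
  toFun z := ((z.1 ^ n.1 * z.2 ^ (n.2 - n.1) : Circle) : ℂ)
  continuous_toFun := by
    have hc : Continuous fun w : Circle => (w : ℂ) := by fun_prop
    have h : Continuous fun z : Torus => z.1 ^ n.1 * z.2 ^ (n.2 - n.1) :=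
      (continuous_fst.zpow n.1).mul (continuous_snd.zpow (n.2 - n.1))
    exact hc.comp h

theorem torusChar_apply (n : ℤ × ℤ) (z : Torus) :
    torusChar n z = ((z.1 ^ n.1 * z.2 ^ (n.2 - n.1) : Circle) : ℂ) := rfl

theorem norm_torusChar (n : ℤ × ℤ) (z : Torus) : ‖torusChar n z‖ = 1 := Circle.norm_coe _

theorem torusChar_zero (z : Torus) : torusChar 0 z = 1 := by simp [torusChar_apply]

theorem torusChar_add (m n : ℤ × ℤ) (z : Torus) :
    torusChar (m + n) z = torusChar m z * torusChar n z := by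
  rw [torusChar_apply, torusChar_apply, torusChar_apply, ← Circle.coe_mul, Prod.fst_add,
    Prod.snd_add, add_sub_add_comm, zpow_add, zpow_add, mul_mul_mul_comm]

theorem torusChar_neg (n : ℤ × ℤ) (z : Torus) : torusChar (-n) z = conj (torusChar n z) := by
  rw [torusChar_apply, torusChar_apply, ← Circle.coe_inv_eq_conj, mul_inv, Prod.fst_neg,
    Prod.snd_neg, ← neg_sub', zpow_neg, zpow_neg]

theorem torusChar_mul (n : ℤ × ℤ) (w z : Torus) :
    torusChar n (w * z) = torusChar n w * torusChar n z := by
  rw [torusChar_apply, torusChar_apply, torusChar_apply, ← Circle.coe_mul, Prod.fst_mul,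
    Prod.snd_mul, mul_zpow, mul_zpow, mul_mul_mul_comm]

/-- Linear combinations of characters are dense in the continuous functions on the torus. -/
theorem span_torusChar_topologicalClosure :
    (Submodule.span ℂ (Set.range torusChar)).topologicalClosure = ⊤ := by
  let S : StarSubalgebra ℂ C(Torus, ℂ) :=
    { toSubalgebra := Algebra.adjoin ℂ (Set.range torusChar)
      star_mem' := by
        change Algebra.adjoin ℂ (Set.range torusChar) ≤
          star (Algebra.adjoin ℂ (Set.range torusChar))
        refine Algebra.adjoin_le ?_
        rintro _ ⟨n, rfl⟩
        refine Algebra.subset_adjoin ⟨-n, ?_⟩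
        ext z
        rw [torusChar_neg]
        rfl }
  have hS : S.toSubalgebra.toSubmodule = Submodule.span ℂ (Set.range torusChar) := by
    apply Algebra.adjoin_eq_span_of_subset
    refine .trans (fun x ↦ Submonoid.closure_induction (fun _ ↦ id) ⟨0, ?_⟩ ?_)
      Submodule.subset_span
    · ext z
      exact torusChar_zero z
    · rintro _ _ _ _ ⟨m, rfl⟩ ⟨n, rfl⟩
      exact ⟨m + n, ContinuousMap.ext fun z => torusChar_add m n z⟩
  -- The indices (0, 1) and (1, 1) belong to the coordinate functions z₂ and z₁.
  have hsep : S.SeparatesPoints := by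
    intro z w hzw
    by_cases h1 : z.1 = w.1
    · have h2 : z.2 ≠ w.2 := fun h2 => hzw (Prod.ext h1 h2)
      refine ⟨_, ⟨torusChar (0, 1), Algebra.subset_adjoin ⟨(0, 1), rfl⟩, rfl⟩, ?_⟩
      simpa [torusChar_apply, Circle.ext_iff] using h2
    · refine ⟨_, ⟨torusChar (1, 1), Algebra.subset_adjoin ⟨(1, 1), rfl⟩, rfl⟩, ?_⟩
      simpa [torusChar_apply, Circle.ext_iff] using h1
  rw [← hS]
  exact congr_arg (Subalgebra.toSubmodule <| StarSubalgebra.toSubalgebra ·)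
    (ContinuousMap.starSubalgebra_topologicalClosure_eq_top_of_separatesPoints S hsep)

theorem exists_torusChar_ne_one {n : ℤ × ℤ} (hn : n ≠ 0) : ∃ w, torusChar n w ≠ 1 := by
  -- The m-th power of exp(iπ/m) is -1.
  have key : ∀ m : ℤ, m ≠ 0 → ((Circle.exp (Real.pi / m) ^ m : Circle) : ℂ) ≠ 1 := fun m hm => by
    have hm' : (m : ℂ) ≠ 0 := Int.cast_ne_zero.mpr hm
    rw [Circle.coe_zpow, Circle.coe_exp, ← Complex.exp_int_mul]
    push_cast
    rw [show (m : ℂ) * (Real.pi / m * Complex.I) = Real.pi * Complex.I by field_simp,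
      Complex.exp_pi_mul_I]
    norm_num
  by_cases h1 : n.1 = 0
  · have h2 : n.2 - n.1 ≠ 0 := fun h => hn (Prod.ext h1 (by simp; omega))
    exact ⟨(1, Circle.exp (Real.pi / (n.2 - n.1 : ℤ))), by
      simpa [torusChar_apply] using key _ h2⟩
  · exact ⟨(Circle.exp (Real.pi / n.1), 1), by simpa [torusChar_apply] using key _ h1⟩

/-- Translation by w multiplies the integral by χ_n(w), which differs from 1 for a suitable w when n
≠ 0. -/
theorem integral_torusChar (n : ℤ × ℤ) :
    ∫ z, torusChar n z ∂torusHaar = if n = 0 then 1 else 0 := by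
  split_ifs with hn
  · subst hn
    simp [torusChar_zero]
  · obtain ⟨w, hw⟩ := exists_torusChar_ne_one hn
    have h := integral_mul_left_eq_self (μ := torusHaar) (torusChar n) w
    simp_rw [torusChar_mul] at h
    rw [integral_const_mul] at h
    by_contra h0
    exact hw (mul_right_cancel₀ h0 (h.trans (one_mul _).symm))

theorem integrable_torusHaar_of_continuous {f : Torus → ℂ} (hf : Continuous f) :
    Integrable f torusHaar :=
  hf.integrable_of_hasCompactSupport (HasCompactSupport.of_compactSpace f)

/-- A continuous function on the torus all of whose Fourier coefficients vanish is zero. -/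
theorem eq_zero_of_integral_mul_torusChar_eq_zero {f : Torus → ℂ} (hf : Continuous f)
    (h : ∀ n, ∫ z, f z * torusChar n z ∂torusHaar = 0) : f = 0 := by
  have hint : ∀ φ : C(Torus, ℂ), Integrable (fun z => f z * φ z) torusHaar := fun φ =>
    integrable_torusHaar_of_continuous (hf.mul φ.continuous)
  obtain ⟨C, hC⟩ := isCompact_univ.exists_bound_of_continuousOn hf.continuousOn
  let Λ : C(Torus, ℂ) →ₗ[ℂ] ℂ :=
    { toFun := fun φ => ∫ z, f z * φ z ∂torusHaar
      map_add' := fun φ ψ => by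
        simp only [ContinuousMap.add_apply, mul_add]
        exact integral_add (hint φ) (hint ψ)
      map_smul' := fun c φ => by
        simp only [ContinuousMap.smul_apply, smul_eq_mul, RingHom.id_apply, mul_left_comm _ c]
        exact integral_const_mul _ _ }
  let Λc : C(Torus, ℂ) →L[ℂ] ℂ := Λ.mkContinuous C fun φ => by
    refine (norm_integral_le_of_norm_le_const (C := C * ‖φ‖) (ae_of_all _ fun z => ?_)).trans ?_
    · rw [norm_mul]
      exact mul_le_mul (hC z trivial) (φ.norm_coe_le_norm z) (norm_nonneg _)
        ((norm_nonneg _).trans (hC z trivial))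
    · simp
  have hker : (Submodule.span ℂ (Set.range torusChar)).topologicalClosure ≤
      LinearMap.ker Λc.toLinearMap := by
    refine Submodule.topologicalClosure_minimal _ (Submodule.span_le.mpr ?_) Λc.isClosed_ker
    rintro _ ⟨n, rfl⟩
    exact h n
  rw [span_torusChar_topologicalClosure] at hker
  -- The functional φ ↦ ∫ f φ vanishes on a dense subspace, hence also at the conjugate of f.
  have h0 : ∫ z, f z * conj (f z) ∂torusHaar = 0 :=
    hker (Submodule.mem_top (x := (⟨fun z => conj (f z), by fun_prop⟩ : C(Torus, ℂ))))
  have h1 : ∫ z, ‖f z‖ ^ 2 ∂torusHaar = 0 := by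
    simp_rw [Complex.mul_conj, Complex.normSq_eq_norm_sq] at h0
    rw [integral_complex_ofReal] at h0
    exact_mod_cast h0
  have hc2 : Continuous fun z => ‖f z‖ ^ 2 := by fun_prop
  rw [integral_eq_zero_iff_of_nonneg (fun z => by positivity)
    (hc2.integrable_of_hasCompactSupport (HasCompactSupport.of_compactSpace _))] at h1
  have h2 := (hc2.ae_eq_iff_eq torusHaar continuous_zero).mp h1
  ext z
  simpa using congr_fun h2 z

/-- The Fourier coefficient of a function on the torus. -/
def torusCoeff (f : Torus → ℂ) (n : ℤ × ℤ) : ℂ := ∫ z, f z * torusChar (-n) z ∂torusHaar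

theorem torusCoeff_zero (f : Torus → ℂ) : torusCoeff f 0 = ∫ z, f z ∂torusHaar := by
  simp [torusCoeff, torusChar_zero]

/-- Fourier inversion for continuous functions with summable Fourier coefficients. -/
theorem hasSum_torusCoeff {f : Torus → ℂ} (hf : Continuous f)
    (hs : Summable fun n => ‖torusCoeff f n‖) (z : Torus) :
    HasSum (fun n => torusCoeff f n * torusChar n z) (f z) := by
  have hb : ∀ n z, ‖torusCoeff f n * torusChar n z‖ = ‖torusCoeff f n‖ := fun n z => by
    rw [norm_mul, norm_torusChar, mul_one]
  have hsz : ∀ z, Summable fun n => torusCoeff f n * torusChar n z := fun z =>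
    Summable.of_norm (by simpa only [hb] using hs)
  -- The sum of the Fourier series is continuous and has the Fourier coefficients of f, so it equals
  -- f.
  set F : Torus → ℂ := fun z => ∑' n, torusCoeff f n * torusChar n z with hF
  have hFc : Continuous F := continuous_tsum
    (fun n => continuous_const.mul (torusChar n).continuous) hs fun n z => (hb n z).le
  have hcoef : ∀ m, ∫ z, F z * torusChar m z ∂torusHaar
      = ∫ z, f z * torusChar m z ∂torusHaar := fun m => by
    have hb' : ∀ n z, ‖torusCoeff f n * torusChar n z * torusChar m z‖ = ‖torusCoeff f n‖ :=
      fun n z => by rw [norm_mul, hb, norm_torusChar, mul_one]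
    have h := hasSum_integral_of_summable_integral_norm (μ := torusHaar)
      (F := fun n z => torusCoeff f n * torusChar n z * torusChar m z)
      (fun n => integrable_torusHaar_of_continuous
        ((continuous_const.mul (torusChar n).continuous).mul (torusChar m).continuous))
      (by simp_rw [hb']; simpa using hs)
    have h2 : ∀ n, ∫ z, torusCoeff f n * torusChar n z * torusChar m z ∂torusHaar
        = if n = -m then torusCoeff f (-m) else 0 := fun n => by
      simp_rw [mul_assoc, ← torusChar_add]
      rw [integral_const_mul, integral_torusChar]
      by_cases hnm : n = -m
      · subst hnm; simp
      · rw [if_neg hnm, if_neg (fun h => hnm (eq_neg_of_add_eq_zero_left h)), mul_zero]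
    simp_rw [h2, tsum_mul_right] at h
    rw [h.unique (hasSum_ite_eq (-m) _), torusCoeff, neg_neg]
  have hzero : (fun z => F z - f z) = 0 := by
    refine eq_zero_of_integral_mul_torusChar_eq_zero (hFc.sub hf) fun n => ?_
    simp_rw [sub_mul]
    rw [integral_sub (f := fun z => F z * torusChar n z) (g := fun z => f z * torusChar n z)
      (integrable_torusHaar_of_continuous (hFc.mul (torusChar n).continuous))
      (integrable_torusHaar_of_continuous (hf.mul (torusChar n).continuous)), hcoef, sub_self]
  rw [← sub_eq_zero.mp (congr_fun hzero z)]
  exact (hsz z).hasSum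

/-! ### Correlations with characters along the iterates. -/

/-- The Fourier expansion of the composition of a character with `blaschkeTorusMap`. -/
theorem hasSum_torusChar_blaschkeTorusMap {lam : ℂ} (hlam : ‖lam‖ < 1) (n : ℤ × ℤ) (z : Torus) :
    HasSum (fun j => transferCoeff lam n.2 j * torusChar (transferIndex n j) z)
      (torusChar n (blaschkeTorusMap lam hlam z)) := by
  set w := blaschke lam hlam z.1 with hw
  have h1 : HasSum (fun j : ℕ => transferCoeff lam n.2 j *
      ((z.1 ^ (if 0 ≤ n.2 then (j : ℤ) else -j) : Circle) : ℂ)) ((w ^ n.2 : Circle) : ℂ) := by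
    have h := hasSum_blaschkeCoeff hlam n.2.natAbs z.1
    rw [← hw] at h
    by_cases hy : 0 ≤ n.2
    · obtain ⟨N, hN⟩ := Int.eq_ofNat_of_zero_le hy
      simpa [transferCoeff, hN] using h
    · obtain ⟨N, hN⟩ := Int.eq_ofNat_of_zero_le (neg_nonneg.mpr (not_le.mp hy).le)
      have h' := Complex.hasSum_conj'.mpr h
      have e : ((w ^ n.2 : Circle) : ℂ) = conj ((w : ℂ) ^ n.2.natAbs) := by
        rw [← Circle.coe_pow, ← Circle.coe_inv_eq_conj, ← neg_neg n.2, hN]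
        simp
      rw [e]
      refine h'.congr_fun fun j => ?_
      rw [transferCoeff, if_neg hy, if_neg hy, map_mul, ← Circle.coe_pow,
        ← Circle.coe_inv_eq_conj, zpow_neg, zpow_natCast]
  have h2 := h1.mul_left ((z.1 ^ n.1 * z.2 ^ n.2 : Circle) : ℂ)
  have e : ((z.1 ^ n.1 * z.2 ^ n.2 : Circle) : ℂ) * ((w ^ n.2 : Circle) : ℂ)
      = torusChar n (blaschkeTorusMap lam hlam z) := by
    rw [torusChar_apply, ← Circle.coe_mul, blaschkeTorusMap, ← hw]
    congr 1
    rw [mul_assoc z.1, mul_zpow z.1, mul_assoc (z.1 ^ n.1) _ ((w * z.2) ^ _), ← zpow_add,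
      add_sub_cancel, mul_zpow, mul_assoc, mul_comm (z.2 ^ n.2)]
  rw [← e]
  refine h2.congr_fun fun j => ?_
  rw [torusChar_apply, transferIndex, add_sub_cancel_left, zpow_add, Circle.coe_mul,
    Circle.coe_mul, Circle.coe_mul]
  ring

theorem continuous_blaschkeTorusMap_iterate (lam : ℂ) (hlam : ‖lam‖ < 1) (k : ℕ) :
    Continuous (blaschkeTorusMap lam hlam)^[k] :=
  (continuous_blaschkeTorusMap lam hlam).iterate k

/-- A bound on the correlations of a continuous function with the characters propagates along
the iterates of `blaschkeTorusMap` if the bound is contracted by the transfer coefficients. -/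
theorem norm_integral_mul_torusChar_iterate_le {lam : ℂ} (hlam : ‖lam‖ < 1) {g : Torus → ℂ}
    (hg : Continuous g) {W : ℤ × ℤ → ℝ} {θ A : ℝ} (hA : 0 ≤ A) (hθ : 0 ≤ θ)
    (hW : ∀ n : ℤ × ℤ, n ≠ 0 →
      Summable (fun j => ‖transferCoeff lam n.2 j‖ * W (transferIndex n j)) ∧
      ∑' j, ‖transferCoeff lam n.2 j‖ * W (transferIndex n j) ≤ θ * W n)
    (h0 : ∀ n, n ≠ 0 → ‖∫ z, g z * torusChar n z ∂torusHaar‖ ≤ A * W n) (k : ℕ) :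
    ∀ n : ℤ × ℤ, n ≠ 0 →
      ‖∫ z, g z * torusChar n ((blaschkeTorusMap lam hlam)^[k] z) ∂torusHaar‖
        ≤ A * θ ^ k * W n := by
  set T := blaschkeTorusMap lam hlam with hT
  induction k with
  | zero => intro n hn; simpa using h0 n hn
  | succ k ih =>
    intro n hn
    obtain ⟨C, hC⟩ := isCompact_univ.exists_bound_of_continuousOn hg.continuousOn
    set F : ℕ → Torus → ℂ := fun j z =>
      g z * (transferCoeff lam n.2 j * torusChar (transferIndex n j) (T^[k] z)) with hF
    have hFc : ∀ j, Continuous (F j) := fun j => hg.mul (continuous_const.mul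
      ((torusChar _).continuous.comp (continuous_blaschkeTorusMap_iterate lam hlam k)))
    have hFb : ∀ j z, ‖F j z‖ ≤ C * ‖transferCoeff lam n.2 j‖ := fun j z => by
      rw [hF, norm_mul, norm_mul, norm_torusChar, mul_one]
      exact mul_le_mul_of_nonneg_right (hC z trivial) (norm_nonneg _)
    have hsc : Summable fun j => C * ‖transferCoeff lam n.2 j‖ := by
      simp_rw [norm_transferCoeff]
      exact (summable_norm_blaschkeCoeff hlam _).mul_left C
    have hsum := hasSum_integral_of_summable_integral_norm (μ := torusHaar) (F := F)
      (fun j => integrable_torusHaar_of_continuous (hFc j))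
      (hsc.of_nonneg_of_le (fun j => integral_nonneg fun _ => norm_nonneg _) fun j => by
        refine (integral_mono (integrable_torusHaar_of_continuous (hFc j)).norm
          (integrable_const _) (hFb j)).trans_eq ?_
        simp)
    have hlim : ∀ z, ∑' j, F j z = g z * torusChar n (T^[k + 1] z) := fun z => by
      -- The expansion of χ_n ∘ T is evaluated at T^k z, so each new character again meets T^k and
      -- the induction hypothesis applies.
      rw [Function.iterate_succ_apply']
      exact ((hasSum_torusChar_blaschkeTorusMap hlam n _).mul_left (g z)).tsum_eq
    simp_rw [hlim] at hsum
    obtain ⟨hWs, hWle⟩ := hW n hn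
    have hterm : ∀ j, ‖∫ z, F j z ∂torusHaar‖
        ≤ A * θ ^ k * (‖transferCoeff lam n.2 j‖ * W (transferIndex n j)) := fun j => by
      have e : ∫ z, F j z ∂torusHaar = transferCoeff lam n.2 j *
          ∫ z, g z * torusChar (transferIndex n j) (T^[k] z) ∂torusHaar := by
        rw [← integral_const_mul]
        exact integral_congr_ae (ae_of_all _ fun z => mul_left_comm _ _ _)
      rw [e, norm_mul]
      -- In the excluded case the target frequency may be zero, where no bound is available, but the
      -- coefficient vanishes.
      by_cases hj : n.2 = 0 → j = 0
      · calc _ ≤ ‖transferCoeff lam n.2 j‖ * (A * θ ^ k * W (transferIndex n j)) :=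
              mul_le_mul_of_nonneg_left (ih _ (transferIndex_ne_zero hn hj)) (norm_nonneg _)
          _ = _ := by ring
      · push Not at hj
        rw [hj.1, transferCoeff_zero_left lam hj.2]
        simp
    calc _ ≤ A * θ ^ k * ∑' j, ‖transferCoeff lam n.2 j‖ * W (transferIndex n j) :=
          hsum.norm_le_of_bounded (hWs.hasSum.mul_left _) hterm
      _ ≤ A * θ ^ k * (θ * W n) := by gcongr
      _ = _ := by ring

/-! ### Exponential decay of Fourier coefficients of analytic functions. -/

/-- If `f` is analytic and bounded by `C` on the annulus `R⁻¹ ≤ |ζ| ≤ R`, then its Fourier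
coefficients on the unit circle decay like `R ^ (-|m|)`. -/
theorem norm_integral_circle_mul_zpow_le {f : ℂ → ℂ} {R C : ℝ} (hR : 1 ≤ R)
    (hd : ∀ ζ : ℂ, R⁻¹ ≤ ‖ζ‖ → ‖ζ‖ ≤ R → DifferentiableAt ℂ f ζ)
    (hC : ∀ ζ : ℂ, R⁻¹ ≤ ‖ζ‖ → ‖ζ‖ ≤ R → ‖f ζ‖ ≤ C) (m : ℤ) :
    ‖∫ t in (0 : ℝ)..2 * Real.pi, f (Circle.exp t) * ((Circle.exp t ^ m : Circle) : ℂ)‖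
      ≤ 2 * Real.pi * (C * R⁻¹ ^ m.natAbs) := by
  have hR0 : 0 < R := by linarith
  have hRi0 : 0 < R⁻¹ := inv_pos.mpr hR0
  have hRi : R⁻¹ ≤ 1 := inv_le_one_of_one_le₀ hR
  have hC0 : 0 ≤ C := (norm_nonneg _).trans (hC 1 (by simpa using hRi) (by simpa using hR))
  have hne : ∀ ζ : ℂ, R⁻¹ ≤ ‖ζ‖ → ζ ≠ 0 := fun ζ h =>
    norm_pos_iff.mp (hRi0.trans_le h)
  -- The exponent is m - 1 because dζ = iζ dt supplies the missing power of ζ.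
  set u : ℂ → ℂ := fun ζ => f ζ * ζ ^ (m - 1) with hu
  have hud : ∀ ζ : ℂ, R⁻¹ ≤ ‖ζ‖ → ‖ζ‖ ≤ R → DifferentiableAt ℂ u ζ := fun ζ h1 h2 =>
    (hd ζ h1 h2).mul (differentiableAt_id.zpow (Or.inl (hne ζ h1)))
  have hshift : ∀ a b : ℝ, R⁻¹ ≤ a → a ≤ b → b ≤ R →
      (∮ ζ in C(0, b), u ζ) = ∮ ζ in C(0, a), u ζ := fun a b ha hab hb => by
    refine Complex.circleIntegral_eq_of_differentiable_on_annulus_off_countable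
      (hRi0.trans_le ha) hab Set.countable_empty ?_ ?_
    · intro ζ hζ
      simp only [Set.mem_sdiff, mem_closedBall_zero_iff, mem_ball_zero_iff, not_lt] at hζ
      exact (hud ζ (ha.trans hζ.2) (hζ.1.trans hb)).continuousAt.continuousWithinAt
    · intro ζ hζ
      simp only [Set.mem_sdiff, mem_closedBall_zero_iff, mem_ball_zero_iff, not_le] at hζ
      exact hud ζ (ha.trans hζ.1.2.le) (hζ.1.1.le.trans hb)
  have hbound : ∀ ρ : ℝ, R⁻¹ ≤ ρ → ρ ≤ R →
      ‖∮ ζ in C(0, ρ), u ζ‖ ≤ 2 * Real.pi * (C * ρ ^ m) := fun ρ h1 h2 => by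
    have hρ : 0 < ρ := hRi0.trans_le h1
    refine (circleIntegral.norm_integral_le_of_norm_le_const hρ.le (C := C * ρ ^ (m - 1))
      fun ζ hζ => ?_).trans_eq ?_
    · rw [mem_sphere_zero_iff_norm] at hζ
      rw [hu, norm_mul, norm_zpow, hζ]
      exact mul_le_mul_of_nonneg_right (hC ζ (hζ ▸ h1) (hζ ▸ h2)) (by positivity)
    · rw [zpow_sub_one₀ hρ.ne']
      field_simp
  have hunit : (∮ ζ in C(0, 1), u ζ) = Complex.I *
      ∫ t in (0 : ℝ)..2 * Real.pi, f (Circle.exp t) * ((Circle.exp t ^ m : Circle) : ℂ) := by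
    rw [circleIntegral, ← intervalIntegral.integral_const_mul]
    refine intervalIntegral.integral_congr fun t _ => ?_
    simp only [deriv_circleMap, circleMap, hu, Circle.coe_zpow, Circle.coe_exp, smul_eq_mul,
      Complex.ofReal_one, zero_add, one_mul]
    rw [zpow_sub_one₀ (Complex.exp_ne_zero _)]
    field_simp
  have hnorm : ‖∫ t in (0 : ℝ)..2 * Real.pi,
      f (Circle.exp t) * ((Circle.exp t ^ m : Circle) : ℂ)‖ = ‖∮ ζ in C(0, 1), u ζ‖ := by
    rw [hunit, norm_mul, Complex.norm_I, one_mul]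
  rw [hnorm]
  -- The contour moves inwards for m ≥ 0 and outwards for m ≤ 0, so that |ζ^m| = R^(-|m|).
  rcases le_total 0 m with hm | hm
  · rw [hshift R⁻¹ 1 le_rfl hRi hR]
    refine (hbound R⁻¹ le_rfl (hRi.trans hR)).trans_eq ?_
    rw [← zpow_natCast, Int.natAbs_of_nonneg hm]
  · rw [← hshift 1 R hRi hR le_rfl]
    refine (hbound R (hRi.trans hR) le_rfl).trans_eq ?_
    rw [← zpow_natCast, Int.ofNat_natAbs_of_nonpos hm, inv_zpow', neg_neg]

theorem Torus.continuous_toComplex : Continuous Torus.toComplex := by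
  unfold Torus.toComplex
  fun_prop

theorem AnalyticNearTorus.continuous {g : Torus → ℂ} (hg : AnalyticNearTorus g) :
    Continuous g := by
  obtain ⟨U, G, -, hU, hG, h⟩ := hg
  rw [show g = G ∘ Torus.toComplex from funext h]
  exact hG.continuousOn.comp_continuous Torus.continuous_toComplex fun z => hU ⟨z, rfl⟩

/-- The witness is the radial projection; inside the circle 1 - R⁻¹ ≤ R - 1 is used. -/
theorem exists_norm_sub_circle_le {ζ : ℂ} {R : ℝ} (hR : 1 ≤ R) (h1 : R⁻¹ ≤ ‖ζ‖)
    (h2 : ‖ζ‖ ≤ R) : ∃ w : Circle, ‖ζ - w‖ ≤ R - 1 := by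
  have hR0 : 0 < R := by linarith
  have h0 : 0 < ‖ζ‖ := (inv_pos.mpr hR0).trans_le h1
  have hn : (‖ζ‖ : ℂ) ≠ 0 := Complex.ofReal_ne_zero.mpr h0.ne'
  refine ⟨⟨ζ / ‖ζ‖, mem_sphere_zero_iff_norm.mpr ?_⟩, ?_⟩
  · rw [norm_div, Complex.norm_real, norm_norm, div_self h0.ne']
  · have e : ζ - ζ / ‖ζ‖ = ζ / ‖ζ‖ * ((‖ζ‖ - 1 : ℝ) : ℂ) := by
      push_cast; field_simp
    change ‖ζ - ζ / ‖ζ‖‖ ≤ R - 1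
    rw [e, norm_mul, norm_div, Complex.norm_real, Complex.norm_real, norm_norm, div_self h0.ne',
      one_mul, Real.norm_eq_abs, abs_le]
    have h3 : 1 ≤ R * ‖ζ‖ := by
      rwa [← div_le_iff₀' hR0, one_div]
    constructor <;> nlinarith

/-- The Fourier coefficients of a function analytic near the torus decay exponentially. -/
theorem AnalyticNearTorus.exists_norm_integral_le {g : Torus → ℂ} (hg : AnalyticNearTorus g) :
    ∃ A q : ℝ, 0 ≤ A ∧ 0 < q ∧ q < 1 ∧
      ∀ n, ‖∫ z, g z * torusChar n z ∂torusHaar‖ ≤ A * q ^ (n.1.natAbs + n.2.natAbs) := by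
  have hgc := hg.continuous
  obtain ⟨U, G, hUo, hU, hG, h⟩ := hg
  have hK : IsCompact (Set.range Torus.toComplex) := isCompact_range Torus.continuous_toComplex
  obtain ⟨ε, hε, hεU⟩ := hK.exists_cthickening_subset_open hUo hU
  obtain ⟨C, hC⟩ := (hK.cthickening (r := ε)).exists_bound_of_continuousOn
    (hG.continuousOn.mono hεU)
  -- Rotating one coordinate at a time gives decay in |x| and in |y - x|. Since |x| + |y| ≤ 3
  -- max(|x|, |y - x|), the rate S⁻¹ in the ℓ¹-norm needs annuli of radius S³. The 7 comes from (1 +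
  -- t)³ ≤ 1 + 7t for 0 ≤ t ≤ 1.
  obtain ⟨S, hS1, hS⟩ : ∃ S : ℝ, 1 < S ∧ S ^ 3 ≤ 1 + ε := by
    refine ⟨1 + min ε 1 / 7, by have := lt_min hε one_pos; linarith, ?_⟩
    have h0 := lt_min hε one_pos
    have h1 := min_le_left ε 1
    have h2 := min_le_right ε 1
    nlinarith [mul_nonneg h0.le (sub_nonneg.mpr h2), mul_nonneg (mul_nonneg h0.le h0.le)
      (sub_nonneg.mpr h2)]
  set R := S ^ 3 with hR
  have hR1 : 1 ≤ R := one_le_pow₀ hS1.le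
  have hS0 : 0 < S := by linarith
  have hmem1 : ∀ (z : Torus) (ζ : ℂ), R⁻¹ ≤ ‖ζ‖ → ‖ζ‖ ≤ R →
      (ζ * z.1, (z.2 : ℂ)) ∈ Metric.cthickening ε (Set.range Torus.toComplex) := by
    intro z ζ h1 h2
    obtain ⟨w, hw⟩ := exists_norm_sub_circle_le hR1 h1 h2
    refine Metric.mem_cthickening_of_dist_le _ (Torus.toComplex (w * z.1, z.2)) _ _ ⟨_, rfl⟩ ?_
    rw [Torus.toComplex, Prod.dist_eq, dist_self, Circle.coe_mul, dist_eq_norm, ← sub_mul,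
      norm_mul, Circle.norm_coe, mul_one]
    exact max_le (by linarith) hε.le
  have hmem2 : ∀ (z : Torus) (ζ : ℂ), R⁻¹ ≤ ‖ζ‖ → ‖ζ‖ ≤ R →
      ((z.1 : ℂ), ζ * z.2) ∈ Metric.cthickening ε (Set.range Torus.toComplex) := by
    intro z ζ h1 h2
    obtain ⟨w, hw⟩ := exists_norm_sub_circle_le hR1 h1 h2
    refine Metric.mem_cthickening_of_dist_le _ (Torus.toComplex (z.1, w * z.2)) _ _ ⟨_, rfl⟩ ?_
    rw [Torus.toComplex, Prod.dist_eq, dist_self, Circle.coe_mul, dist_eq_norm, ← sub_mul,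
      norm_mul, Circle.norm_coe, mul_one]
    exact max_le hε.le (by linarith)
  have hpi : 0 < 2 * Real.pi := by positivity
  have hfc : ∀ n, Continuous fun z => g z * torusChar n z := fun n =>
    hgc.mul (torusChar n).continuous
  have hfirst : ∀ n : ℤ × ℤ, ‖∫ z, g z * torusChar n z ∂torusHaar‖ ≤ C * R⁻¹ ^ n.1.natAbs := by
    intro n
    refine le_of_mul_le_mul_left (norm_integral_torusHaar_le_of_average (hfc n)
      (e := fun t => (Circle.exp t, 1)) (by fun_prop) fun z => ?_) hpi
    have hb := norm_integral_circle_mul_zpow_le (f := fun ζ => G (ζ * z.1, z.2)) hR1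
      (fun ζ h1 h2 => (hG _ (hεU (hmem1 z ζ h1 h2))).differentiableAt.comp ζ
        (by fun_prop : DifferentiableAt ℂ (fun ζ : ℂ => (ζ * z.1, (z.2 : ℂ))) ζ))
      (fun ζ h1 h2 => hC _ (hmem1 z ζ h1 h2)) n.1
    refine le_of_eq_of_le ?_ hb
    rw [← mul_one ‖∫ t in (0 : ℝ)..2 * Real.pi, G (Circle.exp t * z.1, z.2) * _‖,
      ← norm_torusChar n z, ← norm_mul, ← intervalIntegral.integral_mul_const]
    congr 1
    refine intervalIntegral.integral_congr fun t _ => ?_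
    simp only [torusChar_mul, h, Torus.toComplex, Prod.fst_mul, Prod.snd_mul, Circle.coe_mul,
      one_mul]
    simp [torusChar_apply, mul_assoc]
  have hsecond : ∀ n : ℤ × ℤ,
      ‖∫ z, g z * torusChar n z ∂torusHaar‖ ≤ C * R⁻¹ ^ (n.2 - n.1).natAbs := by
    intro n
    refine le_of_mul_le_mul_left (norm_integral_torusHaar_le_of_average (hfc n)
      (e := fun t => (1, Circle.exp t)) (by fun_prop) fun z => ?_) hpi
    have hb := norm_integral_circle_mul_zpow_le (f := fun ζ => G (z.1, ζ * z.2)) hR1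
      (fun ζ h1 h2 => (hG _ (hεU (hmem2 z ζ h1 h2))).differentiableAt.comp ζ
        (by fun_prop : DifferentiableAt ℂ (fun ζ : ℂ => ((z.1 : ℂ), ζ * z.2)) ζ))
      (fun ζ h1 h2 => hC _ (hmem2 z ζ h1 h2)) (n.2 - n.1)
    refine le_of_eq_of_le ?_ hb
    rw [← mul_one ‖∫ t in (0 : ℝ)..2 * Real.pi, G (z.1, Circle.exp t * z.2) * _‖,
      ← norm_torusChar n z, ← norm_mul, ← intervalIntegral.integral_mul_const]
    congr 1
    refine intervalIntegral.integral_congr fun t _ => ?_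
    simp only [torusChar_mul, h, Torus.toComplex, Prod.fst_mul, Prod.snd_mul, Circle.coe_mul,
      one_mul]
    simp [torusChar_apply, mul_assoc]
  have hC0 : 0 ≤ C := (norm_nonneg _).trans (hC _ (by
    simpa using hmem1 1 1 (by simpa using inv_le_one_of_one_le₀ hR1) (by simpa using hR1)))
  have hq0 : 0 < S⁻¹ := inv_pos.mpr hS0
  have hq1 : S⁻¹ < 1 := inv_lt_one_of_one_lt₀ hS1
  refine ⟨C, S⁻¹, hC0, hq0, hq1, fun n => ?_⟩
  have hRq : ∀ m : ℕ, R⁻¹ ^ m = S⁻¹ ^ (3 * m) := fun m => by rw [hR, pow_mul, inv_pow S]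
  rcases le_total n.1.natAbs (n.2 - n.1).natAbs with hle | hle
  · refine (hsecond n).trans (mul_le_mul_of_nonneg_left ?_ hC0)
    rw [hRq]
    exact pow_le_pow_of_le_one hq0.le hq1.le (by omega)
  · refine (hfirst n).trans (mul_le_mul_of_nonneg_left ?_ hC0)
    rw [hRq]
    exact pow_le_pow_of_le_one hq0.le hq1.le (by omega)

theorem analyticNearTorus_torusChar (n : ℤ × ℤ) : AnalyticNearTorus (torusChar n) := by
  refine ⟨{p | p.1 ≠ 0 ∧ p.2 ≠ 0}, fun p => p.1 ^ n.1 * p.2 ^ (n.2 - n.1), ?_, ?_, ?_, ?_⟩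
  · exact (isOpen_ne.preimage continuous_fst).inter (isOpen_ne.preimage continuous_snd)
  · rintro _ ⟨z, rfl⟩
    exact ⟨Circle.coe_ne_zero _, Circle.coe_ne_zero _⟩
  · intro p hp
    exact (analyticAt_fst.zpow hp.1).mul (analyticAt_snd.zpow hp.2)
  · intro z
    simp [torusChar_apply, Torus.toComplex]

/-! ### Exponential decay of correlations. -/

theorem summable_pow_natAbs_add_natAbs {q : ℝ} (hq0 : 0 ≤ q) (hq1 : q < 1) :
    Summable fun n : ℤ × ℤ => q ^ (n.1.natAbs + n.2.natAbs) := by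
  have h : Summable fun m : ℤ => q ^ m.natAbs := by
    refine Summable.of_nat_of_neg ?_ ?_ <;> simpa using summable_geometric_of_lt_one hq0 hq1
  simp_rw [pow_add]
  exact h.mul_of_nonneg h (fun _ => by positivity) (fun _ => by positivity)

theorem exp_neg_mul_freqHeight_le {δ : ℝ} (hδ : 0 ≤ δ) (n : ℤ × ℤ) :
    Real.exp (-δ * freqHeight n) ≤ Real.exp δ ^ (n.1.natAbs + n.2.natAbs) := by
  rw [← Real.exp_nat_mul]
  refine Real.exp_le_exp.mpr ?_
  have h : ((-freqHeight n : ℤ) : ℝ) ≤ (((n.1.natAbs + n.2.natAbs : ℕ) : ℤ) : ℝ) :=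
    Int.cast_le.mpr (by have := neg_freqNorm_le n; unfold freqNorm at this; push_cast at *; omega)
  rw [Int.cast_natCast, Int.cast_neg] at h
  nlinarith

theorem exp_neg_pow_le_exp_neg_mul_freqHeight {δ : ℝ} (hδ : 0 ≤ δ) (n : ℤ × ℤ) :
    Real.exp (-δ) ^ (n.1.natAbs + n.2.natAbs) ≤ Real.exp (-δ * freqHeight n) := by
  rw [← Real.exp_nat_mul]
  refine Real.exp_le_exp.mpr ?_
  have h : ((freqHeight n : ℤ) : ℝ) ≤ (((n.1.natAbs + n.2.natAbs : ℕ) : ℤ) : ℝ) :=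
    Int.cast_le.mpr (by have := freqHeight_le n; unfold freqNorm at this; push_cast at *; omega)
  rw [Int.cast_natCast] at h
  nlinarith

/-- The correlation of two functions is controlled by the Fourier coefficients of the second one
and the correlations of the first one with the nontrivial characters. -/
theorem norm_correlation_le_tsum {lam : ℂ} (hlam : ‖lam‖ < 1) {g h : Torus → ℂ}
    (hgc : Continuous g) (hhc : Continuous h) (hcs : Summable fun n => ‖torusCoeff h n‖)
    {W : ℤ × ℤ → ℝ} (hW0 : ∀ n, 0 ≤ W n) (hcWs : Summable fun n => ‖torusCoeff h n‖ * W n)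
    {D : ℝ} (hD : 0 ≤ D) (k : ℕ)
    (hiter : ∀ n : ℤ × ℤ, n ≠ 0 →
      ‖∫ z, g z * torusChar n ((blaschkeTorusMap lam hlam)^[k] z) ∂torusHaar‖ ≤ D * W n) :
    ‖correlation (blaschkeTorusMap lam hlam) torusHaar g h k‖
      ≤ D * ∑' n, ‖torusCoeff h n‖ * W n := by
  set T := blaschkeTorusMap lam hlam with hT
  obtain ⟨M, hM⟩ := isCompact_univ.exists_bound_of_continuousOn hgc.continuousOn
  have hTc : Continuous T^[k] := continuous_blaschkeTorusMap_iterate lam hlam k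
  set F : ℤ × ℤ → Torus → ℂ :=
    fun n z => g z * (torusCoeff h n * torusChar n (T^[k] z)) with hF
  have hFc : ∀ n, Continuous (F n) := fun n =>
    hgc.mul (continuous_const.mul ((torusChar n).continuous.comp hTc))
  have hFb : ∀ n z, ‖F n z‖ ≤ M * ‖torusCoeff h n‖ := fun n z => by
    rw [hF, norm_mul, norm_mul, norm_torusChar, mul_one]
    exact mul_le_mul_of_nonneg_right (hM z trivial) (norm_nonneg _)
  have hsum := hasSum_integral_of_summable_integral_norm (μ := torusHaar) (F := F)
    (fun n => integrable_torusHaar_of_continuous (hFc n))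
    ((hcs.mul_left M).of_nonneg_of_le
      (fun n => integral_nonneg fun _ => norm_nonneg _) fun n => by
      refine (integral_mono (integrable_torusHaar_of_continuous (hFc n)).norm
        (integrable_const _) (hFb n)).trans_eq ?_
      simp)
  have hlim : ∀ z, ∑' n, F n z = g z * h (T^[k] z) := fun z =>
    ((hasSum_torusCoeff hhc hcs _).mul_left (g z)).tsum_eq
  simp_rw [hlim] at hsum
  have hFint : ∀ n, ∫ z, F n z ∂torusHaar
      = torusCoeff h n * ∫ z, g z * torusChar n (T^[k] z) ∂torusHaar := fun n => by
    rw [← integral_const_mul]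
    exact integral_congr_ae (ae_of_all _ fun z => mul_left_comm _ _ _)
  have hzero : ∫ z, F 0 z ∂torusHaar = (∫ z, g z ∂torusHaar) * ∫ z, h z ∂torusHaar := by
    rw [hFint, torusCoeff_zero, mul_comm]
    simp_rw [torusChar_zero, mul_one]
  -- The product of the means is exactly the term n = 0 of the series, so subtracting it leaves the
  -- nonzero frequencies.
  have hcorr := hsum.sub (hasSum_ite_eq (0 : ℤ × ℤ)
    ((∫ z, g z ∂torusHaar) * ∫ z, h z ∂torusHaar))
  have hterm : ∀ n : ℤ × ℤ, ‖(∫ z, F n z ∂torusHaar) -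
      (if n = 0 then (∫ z, g z ∂torusHaar) * ∫ z, h z ∂torusHaar else 0)‖
        ≤ D * (‖torusCoeff h n‖ * W n) := fun n => by
    by_cases hn : n = 0
    · subst hn
      rw [if_pos rfl, hzero, sub_self, norm_zero]
      exact mul_nonneg hD (mul_nonneg (norm_nonneg _) (hW0 0))
    · rw [if_neg hn, sub_zero, hFint, norm_mul]
      calc _ ≤ ‖torusCoeff h n‖ * (D * W n) :=
            mul_le_mul_of_nonneg_left (hiter n hn) (norm_nonneg _)
        _ = _ := by ring
  exact hcorr.norm_le_of_bounded (hcWs.hasSum.mul_left _) hterm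

/-- For every `θ > |λ|` and every `δ > 0` there is a weight on the frequencies of growth and
decay at most `exp (δ * (|x| + |y|))` which the transfer coefficients contract by the factor
`θ`. -/
theorem exists_contracting_weight_of_exponential_type {lam : ℂ} (hlam : ‖lam‖ < 1) {θ δ : ℝ}
    (hθ : ‖lam‖ < θ) (hδ : 0 < δ) :
    ∃ (W : ℤ × ℤ → ℝ) (L : ℝ), 0 < L ∧ (∀ n, 0 < W n) ∧
      (∀ n, W n ≤ L * Real.exp δ ^ (n.1.natAbs + n.2.natAbs)) ∧
      (∀ n, Real.exp (-δ) ^ (n.1.natAbs + n.2.natAbs) ≤ L * W n) ∧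
      ∀ n : ℤ × ℤ, n ≠ 0 →
        Summable (fun j => ‖transferCoeff lam n.2 j‖ * W (transferIndex n j)) ∧
        ∑' j, ‖transferCoeff lam n.2 j‖ * W (transferIndex n j) ≤ θ * W n := by
  obtain ⟨K, R, hK, hR, hW⟩ := exists_contracting_weight hlam hθ hδ
  have hK0 : 0 < K := one_pos.trans_le hK
  have hL : 0 < K ^ R := zpow_pos hK0 R
  refine ⟨fun n => heightWeight δ K R (freqHeight n), K ^ R, hL,
    fun n => heightWeight_pos δ hK0 R _, fun n => ?_, fun n => ?_, hW⟩
  · rw [mul_comm]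
    exact (heightWeight_le δ hK R _).trans
      (mul_le_mul_of_nonneg_right (exp_neg_mul_freqHeight_le hδ.le n) hL.le)
  · have h := mul_le_mul_of_nonneg_left (le_heightWeight δ hK hR (freqHeight n)) hL.le
    rw [mul_left_comm, zpow_neg, mul_inv_cancel₀ hL.ne', mul_one] at h
    exact (exp_neg_pow_le_exp_neg_mul_freqHeight hδ.le n).trans h

/-- Fixes δ from the decay rates p of g and q of h: the first condition puts the coefficients of g
below the weight, the second keeps the weighted sum of those of h finite. -/
theorem exists_exp_bounds {p q : ℝ} (hp0 : 0 < p) (hp1 : p < 1) (hq1 : q < 1) :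
    ∃ δ : ℝ, 0 < δ ∧ p ≤ Real.exp (-δ) ∧ q * Real.exp δ < 1 := by
  have hm0 : 0 < max p q := lt_max_of_lt_left hp0
  obtain ⟨δ, hδ0, hδ⟩ := exists_between (neg_pos.mpr (Real.log_neg hm0 (max_lt hp1 hq1)))
  have hmax : max p q < Real.exp (-δ) := by
    rw [← Real.log_lt_iff_lt_exp hm0]
    linarith
  refine ⟨δ, hδ0, (le_max_left p q).trans hmax.le, ?_⟩
  calc q * Real.exp δ < Real.exp (-δ) * Real.exp δ :=
        mul_lt_mul_of_pos_right ((le_max_right p q).trans_lt hmax) (Real.exp_pos δ)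
    _ = 1 := by rw [← Real.exp_add]; simp

/-- Exponential decay of correlations for functions analytic near the torus, at every rate
`θ > |λ|`. -/
theorem exists_norm_correlation_le {lam : ℂ} (hlam : ‖lam‖ < 1) {g h : Torus → ℂ}
    (hg : AnalyticNearTorus g) (hh : AnalyticNearTorus h) {θ : ℝ} (hθ : ‖lam‖ < θ) :
    ∃ C : ℝ, 0 < C ∧ ∀ k,
      ‖correlation (blaschkeTorusMap lam hlam) torusHaar g h k‖ ≤ C * θ ^ k := by
  have hθ0 : 0 < θ := (norm_nonneg _).trans_lt hθ
  obtain ⟨A, p, hA, hp0, hp1, hgA⟩ := hg.exists_norm_integral_le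
  obtain ⟨B, q, hB, hq0, hq1, hhB⟩ := hh.exists_norm_integral_le
  obtain ⟨δ, hδ0, hpδ, hqδ⟩ := exists_exp_bounds hp0 hp1 hq1
  have hqδ0 : 0 ≤ q * Real.exp δ := mul_nonneg hq0.le (Real.exp_pos δ).le
  obtain ⟨W, L, hL, hW0, hWle, hleW, hW⟩ :=
    exists_contracting_weight_of_exponential_type hlam hθ hδ0
  have hg0 : ∀ n, n ≠ 0 → ‖∫ z, g z * torusChar n z ∂torusHaar‖ ≤ (A * L) * W n := by
    intro n _
    rw [mul_assoc]
    exact (hgA n).trans (mul_le_mul_of_nonneg_left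
      ((pow_le_pow_left₀ hp0.le hpδ _).trans (hleW n)) hA)
  have hAL : 0 ≤ A * L := mul_nonneg hA hL.le
  have hcoef : ∀ n, ‖torusCoeff h n‖ ≤ B * q ^ (n.1.natAbs + n.2.natAbs) := fun n => by
    have := hhB (-n)
    rwa [Prod.fst_neg, Prod.snd_neg, Int.natAbs_neg, Int.natAbs_neg] at this
  have hcs : Summable fun n => ‖torusCoeff h n‖ :=
    ((summable_pow_natAbs_add_natAbs hq0.le hq1).mul_left B).of_nonneg_of_le
      (fun _ => norm_nonneg _) hcoef
  have hcW : ∀ n, ‖torusCoeff h n‖ * W n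
      ≤ B * L * (q * Real.exp δ) ^ (n.1.natAbs + n.2.natAbs) := fun n => by
    refine (mul_le_mul (hcoef n) (hWle n) (hW0 n).le (by positivity)).trans_eq ?_
    rw [mul_pow]
    ring
  have hcWs : Summable fun n => ‖torusCoeff h n‖ * W n :=
    ((summable_pow_natAbs_add_natAbs hqδ0 hqδ).mul_left (B * L)).of_nonneg_of_le
      (fun n => mul_nonneg (norm_nonneg _) (hW0 n).le) hcW
  have hS0 : 0 ≤ ∑' n, ‖torusCoeff h n‖ * W n :=
    tsum_nonneg fun n => mul_nonneg (norm_nonneg _) (hW0 n).le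
  refine ⟨A * L * (∑' n, ‖torusCoeff h n‖ * W n) + 1,
    add_pos_of_nonneg_of_pos (mul_nonneg hAL hS0) one_pos, fun k => ?_⟩
  have hk := norm_correlation_le_tsum hlam hg.continuous hh.continuous hcs (fun n => (hW0 n).le)
    hcWs (mul_nonneg hAL (pow_nonneg hθ0.le k)) k
    (norm_integral_mul_torusChar_iterate_le hlam hg.continuous hAL hθ0.le hW hg0 k)
  have hθk : 0 ≤ θ ^ k := pow_nonneg hθ0.le k
  linarith

/-- Since C^(1/k) → 1, the constants, which may depend on θ, disappear in the limit for each fixed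
θ; then θ ↓ r. -/
theorem limsup_enorm_rpow_le {a : ℕ → ℂ} {r : ℝ} (hr : 0 ≤ r)
    (h : ∀ θ, r < θ → ∃ C : ℝ, 0 < C ∧ ∀ k, ‖a k‖ ≤ C * θ ^ k) :
    limsup (fun k : ℕ => ‖a k‖ₑ ^ (1 / (k : ℝ))) atTop ≤ ENNReal.ofReal r := by
  have key : ∀ θ, r < θ →
      limsup (fun k : ℕ => ‖a k‖ₑ ^ (1 / (k : ℝ))) atTop ≤ ENNReal.ofReal θ := by
    intro θ hθ
    obtain ⟨C, hC, hb⟩ := h θ hθ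
    have hθ0 : 0 < θ := hr.trans_lt hθ
    have hlim : Tendsto (fun k : ℕ => ENNReal.ofReal (C ^ (1 / (k : ℝ)) * θ)) atTop
        (𝓝 (ENNReal.ofReal θ)) := by
      refine ENNReal.tendsto_ofReal ?_
      have h1 : Tendsto (fun k : ℕ => C ^ (1 / (k : ℝ))) atTop (𝓝 (C ^ (0 : ℝ))) :=
        (Real.continuousAt_const_rpow hC.ne').tendsto.comp tendsto_one_div_atTop_nhds_zero_nat
      simpa using h1.mul_const θ
    rw [← hlim.limsup_eq]
    refine limsup_le_limsup ?_
    filter_upwards [eventually_gt_atTop 0] with k hk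
    have hk0 : (0 : ℝ) < k := Nat.cast_pos.mpr hk
    have h2 : C ^ (1 / (k : ℝ)) * θ = (C * θ ^ k) ^ (1 / (k : ℝ)) := by
      rw [Real.mul_rpow hC.le (by positivity), one_div, Real.pow_rpow_inv_natCast hθ0.le hk.ne']
    rw [h2, ← ENNReal.ofReal_rpow_of_pos (by positivity)]
    refine ENNReal.rpow_le_rpow ?_ (by positivity)
    rw [← ofReal_norm]
    exact ENNReal.ofReal_le_ofReal (hb k)
  have hcont : Tendsto ENNReal.ofReal (𝓝[>] r) (𝓝 (ENNReal.ofReal r)) :=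
    (ENNReal.continuous_ofReal.tendsto r).mono_left nhdsWithin_le_nhds
  exact ge_of_tendsto hcont (eventually_mem_nhdsWithin.mono key)

/-! ### Stability of correlations under L¹ approximation. -/

section Approximation

variable {X : Type*} [MeasurableSpace X] {T : X → X} {μ : Measure X}

theorem norm_integral_mul_le_of_bounded_left {f g : X → ℂ} {M : ℝ} (hg : Integrable g μ)
    (hf : ∀ x, ‖f x‖ ≤ M) : ‖∫ x, f x * g x ∂μ‖ ≤ M * ∫ x, ‖g x‖ ∂μ := by
  rw [← integral_const_mul]
  refine norm_integral_le_of_norm_le (hg.norm.const_mul M) (ae_of_all _ fun x => ?_)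
  rw [norm_mul]
  exact mul_le_mul_of_nonneg_right (hf x) (norm_nonneg _)

/-- The bound is uniform in k because invariance of μ gives g ∘ T^k the L¹-norm of g. This
uniformity lets limits in k pass through approximation. -/
theorem norm_correlation_le_of_bounded_left [IsProbabilityMeasure μ] (hT : MeasurePreserving T μ μ) {f g : X → ℂ} {M : ℝ}
    (hg : Integrable g μ) (hf : ∀ x, ‖f x‖ ≤ M) (k : ℕ) :
    ‖correlation T μ f g k‖ ≤ 2 * M * ∫ x, ‖g x‖ ∂μ := by
  have hTk := hT.iterate k
  have hgk : ∫ x, ‖g (T^[k] x)‖ ∂μ = ∫ x, ‖g x‖ ∂μ := by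
    have h := integral_map (μ := μ) hTk.measurable.aemeasurable (f := fun x => ‖g x‖)
      (by rw [hTk.map_eq]; exact hg.norm.aestronglyMeasurable)
    rw [hTk.map_eq] at h
    exact h.symm
  have h1 := norm_integral_mul_le_of_bounded_left (hTk.integrable_comp_of_integrable hg) hf
  have h2 : ‖∫ x, f x ∂μ‖ ≤ M := by
    simpa using norm_integral_le_of_norm_le_const (μ := μ) (ae_of_all _ hf)
  have h3 : ‖(∫ x, f x ∂μ) * ∫ x, g x ∂μ‖ ≤ M * ∫ x, ‖g x‖ ∂μ := by
    rw [norm_mul]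
    exact mul_le_mul h2 (norm_integral_le_integral_norm _) (norm_nonneg _)
      ((norm_nonneg _).trans h2)
  simp only [Function.comp_apply] at h1
  rw [hgk] at h1
  refine (norm_sub_le _ _).trans ((add_le_add h1 h3).trans_eq (by ring))

theorem norm_correlation_le_of_bounded_right [IsProbabilityMeasure μ] {f g : X → ℂ} {M : ℝ}
    (hf : Integrable f μ) (hg : ∀ x, ‖g x‖ ≤ M) (k : ℕ) :
    ‖correlation T μ f g k‖ ≤ 2 * M * ∫ x, ‖f x‖ ∂μ := by
  have h1 := norm_integral_mul_le_of_bounded_left (f := fun x => g (T^[k] x)) hf fun x => hg _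
  have h2 : ‖∫ x, g x ∂μ‖ ≤ M := by
    simpa using norm_integral_le_of_norm_le_const (μ := μ) (ae_of_all _ hg)
  have h3 : ‖(∫ x, f x ∂μ) * ∫ x, g x ∂μ‖ ≤ M * ∫ x, ‖f x‖ ∂μ := by
    rw [norm_mul, mul_comm]
    exact mul_le_mul h2 (norm_integral_le_integral_norm _) (norm_nonneg _)
      ((norm_nonneg _).trans h2)
  simp_rw [mul_comm (g _)] at h1
  refine (norm_sub_le _ _).trans ((add_le_add h1 h3).trans_eq (by ring))

theorem integrable_mul_iterate (hT : MeasurePreserving T μ μ) {f g : X → ℂ} {M : ℝ}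
    (hf : Integrable f μ) (hg : Integrable g μ) (hM : ∀ x, ‖f x‖ ≤ M) (k : ℕ) :
    Integrable (fun x => f x * g (T^[k] x)) μ :=
  ((hT.iterate k).integrable_comp_of_integrable hg).bdd_mul hf.aestronglyMeasurable
    (ae_of_all _ hM)

theorem correlation_sub_right (hT : MeasurePreserving T μ μ) {f g h : X → ℂ} {M : ℝ}
    (hf : Integrable f μ) (hg : Integrable g μ) (hh : Integrable h μ) (hM : ∀ x, ‖f x‖ ≤ M)
    (k : ℕ) :
    correlation T μ f (fun x => g x - h x) k = correlation T μ f g k - correlation T μ f h k := by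
  simp only [correlation, mul_sub]
  rw [integral_sub (integrable_mul_iterate hT hf hg hM k) (integrable_mul_iterate hT hf hh hM k),
    integral_sub hg hh]
  ring

theorem correlation_sub_left (hT : MeasurePreserving T μ μ) {f g h : X → ℂ} {M M' : ℝ}
    (hf : Integrable f μ) (hg : Integrable g μ) (hh : Integrable h μ) (hM : ∀ x, ‖f x‖ ≤ M)
    (hM' : ∀ x, ‖g x‖ ≤ M') (k : ℕ) :
    correlation T μ (fun x => f x - g x) h k = correlation T μ f h k - correlation T μ g h k := by
  simp only [correlation, sub_mul]
  rw [integral_sub (integrable_mul_iterate hT hf hh hM k) (integrable_mul_iterate hT hg hh hM' k),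
    integral_sub hf hg]
  ring

theorem tendsto_zero_of_approx {a : ℕ → ℂ}
    (h : ∀ ε : ℝ, 0 < ε → ∃ b : ℕ → ℂ, Tendsto b atTop (𝓝 0) ∧ ∀ k, ‖a k - b k‖ ≤ ε) :
    Tendsto a atTop (𝓝 0) := by
  rw [Metric.tendsto_atTop]
  intro ε hε
  obtain ⟨b, hb, hab⟩ := h (ε / 2) (by linarith)
  obtain ⟨N, hN⟩ := Metric.tendsto_atTop.mp hb (ε / 2) (by linarith)
  refine ⟨N, fun k hk => ?_⟩
  have h1 := hN k hk
  have h2 := hab k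
  rw [dist_zero_right] at h1 ⊢
  calc ‖a k‖ = ‖(a k - b k) + b k‖ := by rw [sub_add_cancel]
    _ ≤ ‖a k - b k‖ + ‖b k‖ := norm_add_le _ _
    _ < ε := by linarith

/-- If the correlations of bounded integrable `f` with a class of bounded functions tend to zero,
then so do those with all functions that the class approximates in `L¹`. -/
theorem tendsto_correlation_right [IsProbabilityMeasure μ] (hT : MeasurePreserving T μ μ) {f g : X → ℂ} {M : ℝ}
    (hf : Integrable f μ) (hM : ∀ x, ‖f x‖ ≤ M) (hg : Integrable g μ)
    (h : ∀ ε : ℝ, 0 < ε → ∃ φ : X → ℂ, Integrable φ μ ∧ ∫ x, ‖g x - φ x‖ ∂μ ≤ ε ∧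
      Tendsto (correlation T μ f φ) atTop (𝓝 0)) :
    Tendsto (correlation T μ f g) atTop (𝓝 0) := by
  refine tendsto_zero_of_approx fun ε hε => ?_
  have hM0 : 0 ≤ M := by
    obtain ⟨x⟩ := nonempty_of_isProbabilityMeasure μ
    exact (norm_nonneg _).trans (hM x)
  obtain ⟨φ, hφ, hφε, hlim⟩ := h (ε / (2 * M + 1)) (by positivity)
  refine ⟨_, hlim, fun k => ?_⟩
  rw [← correlation_sub_right hT hf hg hφ hM]
  refine (norm_correlation_le_of_bounded_left hT (hg.sub hφ) hM k).trans ?_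
  calc _ ≤ 2 * M * (ε / (2 * M + 1)) := by gcongr; exact hφε
    _ ≤ ε := by rw [← mul_div_assoc, div_le_iff₀ (by positivity)]; nlinarith

theorem tendsto_correlation_left [IsProbabilityMeasure μ] (hT : MeasurePreserving T μ μ) {f g : X → ℂ} {M M' : ℝ}
    (hf : Integrable f μ) (hM' : ∀ x, ‖f x‖ ≤ M') (hg : Integrable g μ) (hM : ∀ x, ‖g x‖ ≤ M)
    (h : ∀ ε : ℝ, 0 < ε → ∃ φ : X → ℂ, Integrable φ μ ∧ (∃ M'', ∀ x, ‖φ x‖ ≤ M'') ∧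
      ∫ x, ‖f x - φ x‖ ∂μ ≤ ε ∧ Tendsto (correlation T μ φ g) atTop (𝓝 0)) :
    Tendsto (correlation T μ f g) atTop (𝓝 0) := by
  refine tendsto_zero_of_approx fun ε hε => ?_
  have hM0 : 0 ≤ M := by
    obtain ⟨x⟩ := nonempty_of_isProbabilityMeasure μ
    exact (norm_nonneg _).trans (hM x)
  obtain ⟨φ, hφ, ⟨M'', hM''⟩, hφε, hlim⟩ := h (ε / (2 * M + 1)) (by positivity)
  refine ⟨_, hlim, fun k => ?_⟩
  rw [← correlation_sub_left hT hf hφ hg hM' hM'']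
  refine (norm_correlation_le_of_bounded_right (hf.sub hφ) hM k).trans ?_
  calc _ ≤ 2 * M * (ε / (2 * M + 1)) := by gcongr; exact hφε
    _ ≤ ε := by rw [← mul_div_assoc, div_le_iff₀ (by positivity)]; nlinarith

end Approximation

/-! ### Density of analytic functions and strong mixing. -/

theorem AnalyticNearTorus.add {f g : Torus → ℂ} (hf : AnalyticNearTorus f)
    (hg : AnalyticNearTorus g) : AnalyticNearTorus fun z => f z + g z := by
  obtain ⟨U, F, hUo, hU, hF, hf⟩ := hf
  obtain ⟨V, G, hVo, hV, hG, hg⟩ := hg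
  exact ⟨U ∩ V, fun p => F p + G p, hUo.inter hVo, Set.subset_inter hU hV,
    fun p hp => (hF p hp.1).add (hG p hp.2), fun z => by simp only [hf, hg]⟩

theorem AnalyticNearTorus.const_mul {f : Torus → ℂ} (hf : AnalyticNearTorus f) (c : ℂ) :
    AnalyticNearTorus fun z => c * f z := by
  obtain ⟨U, F, hUo, hU, hF, hf⟩ := hf
  exact ⟨U, fun p => c * F p, hUo, hU, fun p hp => analyticAt_const.mul (hF p hp),
    fun z => by simp only [hf]⟩

theorem analyticNearTorus_of_mem_span {φ : C(Torus, ℂ)}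
    (hφ : φ ∈ Submodule.span ℂ (Set.range torusChar)) : AnalyticNearTorus φ := by
  induction hφ using Submodule.span_induction with
  | mem _ h =>
    obtain ⟨n, rfl⟩ := h
    exact analyticNearTorus_torusChar n
  | zero =>
    have h := (analyticNearTorus_torusChar 0).const_mul 0
    simp only [zero_mul] at h
    exact h
  | add _ _ _ _ hf hg => exact hf.add hg
  | smul c _ _ hf => exact hf.const_mul c

theorem AnalyticNearTorus.integrable {f : Torus → ℂ} (hf : AnalyticNearTorus f) :
    Integrable f torusHaar :=
  integrable_torusHaar_of_continuous hf.continuous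

theorem AnalyticNearTorus.exists_bound {f : Torus → ℂ} (hf : AnalyticNearTorus f) :
    ∃ M, ∀ z, ‖f z‖ ≤ M := by
  obtain ⟨M, hM⟩ := isCompact_univ.exists_bound_of_continuousOn hf.continuous.continuousOn
  exact ⟨M, fun z => hM z trivial⟩

/-- Functions analytic near the torus are dense in `L¹`. -/
theorem exists_analyticNearTorus_integral_norm_sub_le {f : Torus → ℂ}
    (hf : Integrable f torusHaar) {ε : ℝ} (hε : 0 < ε) :
    ∃ φ, AnalyticNearTorus φ ∧ ∫ z, ‖f z - φ z‖ ∂torusHaar ≤ ε := by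
  obtain ⟨g, hg, hgi⟩ := hf.exists_boundedContinuous_integral_sub_le (half_pos hε)
  have hmem : g.toContinuousMap ∈
      (Submodule.span ℂ (Set.range torusChar)).topologicalClosure := by
    rw [span_torusChar_topologicalClosure]
    trivial
  obtain ⟨φ, hφ, hdist⟩ := Metric.mem_closure_iff.mp hmem (ε / 2) (half_pos hε)
  have hφa := analyticNearTorus_of_mem_span hφ
  refine ⟨φ, hφa, ?_⟩
  have hb : ∀ z, ‖g z - φ z‖ ≤ ε / 2 := fun z => by
    rw [← dist_eq_norm]
    exact (ContinuousMap.dist_apply_le_dist (f := g.toContinuousMap) (g := φ) z).trans hdist.le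
  have hi1 : Integrable (fun z => ‖f z - g z‖) torusHaar := (hf.sub hgi).norm
  calc ∫ z, ‖f z - φ z‖ ∂torusHaar ≤ ∫ z, (‖f z - g z‖ + ε / 2) ∂torusHaar := by
        refine integral_mono (hf.sub hφa.integrable).norm (hi1.add (integrable_const _)) fun z => ?_
        calc ‖f z - φ z‖ = ‖(f z - g z) + (g z - φ z)‖ := by rw [sub_add_sub_cancel]
          _ ≤ ‖f z - g z‖ + ‖g z - φ z‖ := norm_add_le _ _
          _ ≤ _ := by gcongr; exact hb z
    _ = (∫ z, ‖f z - g z‖ ∂torusHaar) + ε / 2 := by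
        rw [integral_add hi1 (integrable_const _)]; simp
    _ ≤ ε := by linarith

theorem AnalyticNearTorus.tendsto_correlation {lam : ℂ} (hlam : ‖lam‖ < 1) {g h : Torus → ℂ}
    (hg : AnalyticNearTorus g) (hh : AnalyticNearTorus h) :
    Tendsto (correlation (blaschkeTorusMap lam hlam) torusHaar g h) atTop (𝓝 0) := by
  obtain ⟨θ, hθ, hθ1⟩ := exists_between hlam
  obtain ⟨C, -, hC⟩ := exists_norm_correlation_le hlam hg hh hθ
  refine squeeze_zero_norm hC ?_
  simpa using (tendsto_pow_atTop_nhds_zero_of_lt_one ((norm_nonneg _).trans hθ.le) hθ1).const_mul C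

/-- The two functions are replaced one at a time: g by φ using the bound on h, then h by ψ using the
bound on φ. As φ is fixed before ψ is chosen, its bound may depend on the first accuracy. -/
theorem tendsto_correlation_of_bounded {lam : ℂ} (hlam : ‖lam‖ < 1) {g h : Torus → ℂ}
    (hg : Integrable g torusHaar) (hh : Integrable h torusHaar) {M M' : ℝ}
    (hM : ∀ z, ‖g z‖ ≤ M) (hM' : ∀ z, ‖h z‖ ≤ M') :
    Tendsto (correlation (blaschkeTorusMap lam hlam) torusHaar g h) atTop (𝓝 0) := by
  have hT := measurePreserving_blaschkeTorusMap lam hlam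
  refine tendsto_correlation_left hT hg hM hh hM' fun ε hε => ?_
  obtain ⟨φ, hφ, hφε⟩ := exists_analyticNearTorus_integral_norm_sub_le hg hε
  obtain ⟨M'', hM''⟩ := hφ.exists_bound
  refine ⟨φ, hφ.integrable, ⟨M'', hM''⟩, hφε, ?_⟩
  refine tendsto_correlation_right hT hφ.integrable hM'' hh fun ε hε => ?_
  obtain ⟨ψ, hψ, hψε⟩ := exists_analyticNearTorus_integral_norm_sub_le hh hε
  exact ⟨ψ, hψ.integrable, hψε, hφ.tendsto_correlation hlam hψ⟩

theorem correlation_indicator {X : Type*} [MeasurableSpace X] {T : X → X} {μ : Measure X}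
    (hT : Measurable T) {A B : Set X} (hA : MeasurableSet A) (hB : MeasurableSet B) (k : ℕ) :
    correlation T μ (A.indicator 1) (B.indicator 1) k
      = ((μ.real (A ∩ T^[k] ⁻¹' B) - μ.real A * μ.real B : ℝ) : ℂ) := by
  have h1 : (fun x => A.indicator (1 : X → ℂ) x * B.indicator (1 : X → ℂ) (T^[k] x))
      = (A ∩ T^[k] ⁻¹' B).indicator 1 := by
    rw [Set.inter_indicator_one]
    rfl
  have h2 : ∀ s : Set X, MeasurableSet s → ∫ x, s.indicator (1 : X → ℂ) x ∂μ = (μ.real s : ℂ) :=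
    fun s hs => by
      rw [integral_indicator hs]
      simp
  rw [correlation, h1, h2 _ (hA.inter (hT.iterate k hB)), h2 _ hA, h2 _ hB]
  push_cast
  rfl

theorem stronglyMixing_blaschkeTorusMap (lam : ℂ) (hlam : ‖lam‖ < 1) :
    StronglyMixing (blaschkeTorusMap lam hlam) torusHaar := by
  have hT := measurePreserving_blaschkeTorusMap lam hlam
  refine ⟨hT, fun A B hA hB => ?_⟩
  have hint : ∀ s : Set Torus, MeasurableSet s →
      Integrable (s.indicator (1 : Torus → ℂ)) torusHaar := fun s hs =>
    (integrable_const (1 : ℂ)).indicator hs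
  have hbd : ∀ (s : Set Torus) (z : Torus), ‖s.indicator (1 : Torus → ℂ) z‖ ≤ 1 := fun s z => by
    refine (norm_indicator_le_norm_self _ _).trans ?_
    simp
  have h := tendsto_correlation_of_bounded hlam (hint A hA) (hint B hB) (hbd A) (hbd B)
  have h' : Tendsto (fun k => torusHaar.real (A ∩ (blaschkeTorusMap lam hlam)^[k] ⁻¹' B)
      - torusHaar.real A * torusHaar.real B) atTop (𝓝 0) := by
    have := (Complex.continuous_re.tendsto 0).comp h
    simpa only [Function.comp_def, correlation_indicator hT.measurable hA hB, Complex.ofReal_re,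
      Complex.zero_re] using this
  rw [← ENNReal.tendsto_toReal_iff (fun _ => measure_ne_top _ _)
    (ENNReal.mul_ne_top (measure_ne_top _ _) (measure_ne_top _ _)), ENNReal.toReal_mul]
  exact tendsto_sub_nhds_zero_iff.mp h'

end

theorem corollary1 (lam : ℂ) (hlam : ‖lam‖ < 1) :
    (∀ g h : Torus → ℂ, AnalyticNearTorus g → AnalyticNearTorus h →
      limsup (fun k : ℕ => ‖correlation (blaschkeTorusMap lam hlam) torusHaar g h k‖ₑ ^ (1 / (k : ℝ)))
        atTop ≤ ‖lam‖ₑ) ∧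
    StronglyMixing (blaschkeTorusMap lam hlam) torusHaar := by
  refine ⟨fun g h hg hh => ?_, stronglyMixing_blaschkeTorusMap lam hlam⟩
  rw [← ofReal_norm]
  exact limsup_enorm_rpow_le (norm_nonneg _) fun θ hθ => exists_norm_correlation_le hlam hg hh hθ
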